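/- Let $\Omega\subset\mathbb R^2$ be a bounded polygonal set with a conforming triangulation $\mathcal T_h=\{T_1,\dots,T_K\}$, $h_k=\operatorname{diam}T_k$, and let $N\ge 0$, $M\ge 0$, $\Delta t>0$, $\alpha\in\{0,1\}$. Let $\epsilon$ (a symmetric $2\times2$ matrix function) and $\mu$ (a scalar function) be given on $\Omega$, measurable, with one-sided traces on the edges of every triangle, and let $\underline\epsilon,\underline\mu>0$ and $\overline\epsilon,\overline\mu$ be constants with $\underline\epsilon|\xi|^2\le\xi^T\epsilon\,\xi\le\overline\epsilon|\xi|^2$ for all $\xi\in\mathbb R^2$ and $\underline\mu\le\mu\le\overline\mu$, almost everywhere in $\Omega$ and for the traces on the edges. On an edge of $T_k$ with outward unit normal $n=(n_x,n_y)$ let $\epsilon_{\rm eff}=\det\epsilon/(n^T\epsilon n)$, $c=1/\sqrt{\mu\,\epsilon_{\rm eff}}$, $Z=\mu c$, $Y=1/Z$. The superscripts $-$ and $+$ denote values from $T_k$ and from the neighbour across the edge, and $[v]=v^--v^+$. On edges in $\partial\Omega$ put $Z^+=Z^-$, $Y^+=Y^-$, $[v]=v^-$, and replace $\alpha$ by $1$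 in the fluxes below. Let $V_N$ be the space of triples $(E_x,E_y,H_z)$ of functions that are polynomials of degree at most $N$ on each $T_k$. All equations below are required for every $k$ and all polynomials $u,v,w$ of degree at most $N$ on $T_k$. For given $(E,H)$ (electric field at $t^m$, magnetic field at $t^{m+1/2}$), an electric field $P$ and $\bar E=\frac12(E+P)$, the electric update $E'$ is defined by $$\Big(\epsilon_{xx}\tfrac{E'_x-E_x}{\Delta t}+\epsilon_{xy}\tfrac{E'_y-E_y}{\Delta t},u\Big)_{T_k}=(\partial_yH_z,u)_{T_k}+\Big(\tfrac{-n_y}{Z^++Z^-}\big(Z^+[H_z]-\alpha(n_x[\bar E_y]-n_y[\bar E_x])\big),u\Big)_{\partial T_k},$$ $$\Big(\epsilon_{yx}\tfrac{E'_x-E_x}{\Delta t}+\epsilon_{yy}\tfrac{E'_y-E_y}{\Delta t},v\Big)_{T_k}=-(\partial_xH_z,v)_{T_k}+\Big(\tfrac{n_x}{Z^++Z^-}\big(Z^+[H_z]-\alpha(n_x[\bar E_y]-n_y[\bar E_x])\big),v\Big)_{\partial T_k}.$$ For given $H$ (at $t^{m+1/2}$), $E'$ (at $t^{m+1}$), a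 magnetic field $Q$ and $\bar H=\frac12(H+Q)$, the magnetic update $H'$ is defined by $$\Big(\mu\tfrac{H'_z-H_z}{\Delta t},w\Big)_{T_k}=(\partial_yE'_x-\partial_xE'_y,w)_{T_k}+\Big(\tfrac1{Y^++Y^-}\big(Y^+(n_x[E'_y]-n_y[E'_x])-\alpha[\bar H_z]\big),w\Big)_{\partial T_k}.$$ *Implicit method:* in the step from $(E^m,H^{m+1/2})$ to $(E^{m+1},H^{m+3/2})$, $0\le m<M$, both equations hold with $P=E'=E^{m+1}$ and $Q=H'=H^{m+3/2}$. *Iterative predictor-corrector method:* $E^{m+1,0}=E^m$, $H^{m+3/2,0}=H^{m+1/2}$, and for $n\ge0$, $E^{m+1,n+1}$ is the electric update with $P=E^{m+1,n}$ and $H^{m+3/2,n+1}$ is the magnetic update with $Q=H^{m+3/2,n}$ and the electric field $E^{m+1}$; the values $E^{m+1},H^{m+3/2}$ accepted at the end of the time step are the iterates reached after finitely many inner iterations. Let $C_{inv}>0$, and let $C_\tau>0$ satisfy, for all $k$, all edges $f$ of $T_k$ and all polynomials $u$ of degree at most $N$, $$\|u\|_{L^2(f)}\le C_\tau\sqrt{(N+1)(N+2)}\;h_k^{-1/2}\|u\|_{L^2(T_k)};$$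 if $\epsilon,\mu$ are not constant on each triangle, let $C_\tau$ satisfy this with $\partial T_k$ in place of $f$ (which can be achieved by replacing $C_\tau$ by $\sqrt3\,C_\tau$). Put $$C_E=\tfrac12C_{inv}N^2+C_\tau^2(N+1)(N+2)\Big(\tfrac52+\tfrac{\alpha+1/4}{\min Z_k}\Big),\qquad C_H=\tfrac12C_{inv}N^2+C_\tau^2(N+1)(N+2)\Big(\tfrac52+\tfrac{\alpha+1/2}{\min Y_k}\Big),$$ where $\min Z_k$, $\min Y_k$ are the infima of $Z^-$ and $Y^-$ over all edges of all triangles. **Theorem.** If $$\Delta t<\frac{\min\{\underline\epsilon,\underline\mu\}}{\max\{C_E,C_H\}}\min_k h_k,$$ then: (1) every inner iteration is uniquely solvable; (2) for all data $(E^m,H^{m+1/2})\in V_N$ the implicit step has a unique solution, and the inner iterates $(E^{m+1,n},H^{m+3/2,n})$ converge to it in $L^2(\Omega)$ as $n\to\infty$, whether the magnetic equation uses for $E^{m+1}$ the limit of the electric iterates or the current iterate $E^{m+1,n+1}$; (3) for all initial data in $V_N$ the implicit method has a unique solution for $0\le m\le M$, and the solutions of the iterative method with the same initial data converge to it in $L^2(\Omega)$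 for every $m\le M$ (uniformly in $m\le M$) as the numbers of inner iterations in the time steps all tend to infinity. -/

import Mathlib

open MeasureTheory Filter Topology

noncomputable section

namespace MaxwellDG

/-- The Euclidean plane. -/
abbrev Plane : Type := EuclideanSpace ℝ (Fin 2)

/-- Polynomials in two variables of total degree at most `N`. -/
abbrev Poly (N : ℕ) : Type := MvPolynomial.restrictTotalDegree (Fin 2) ℝ N

/-- The value of a polynomial at a point of the plane. -/
def val (p : MvPolynomial (Fin 2) ℝ) (x : Plane) : ℝ := MvPolynomial.eval (fun i => x i) p

/-- A conforming triangulation of a bounded polygonal set by `K` nondegenerate triangles: two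
different triangles have different vertex sets, and they meet exactly in the convex hull of their
common vertices (nothing, one vertex, or one whole edge). -/
structure TriMesh where
  K : ℕ
  K_pos : 0 < K
  tri : Fin K → Affine.Triangle ℝ Plane
  vertices_ne : ∀ i j, i ≠ j → Set.range (tri i).points ≠ Set.range (tri j).points
  conforming : ∀ i j, i ≠ j →
    convexHull ℝ (Set.range (tri i).points) ∩ convexHull ℝ (Set.range (tri j).points) =
      convexHull ℝ (Set.range (tri i).points ∩ Set.range (tri j).points)

namespace TriMesh

variable (T : TriMesh)

/-- The closed triangle with index `k`. -/
def cell (k : Fin T.K) : Set Plane := convexHull ℝ (Set.range (T.tri k).points)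

/-- The diameter of the triangle with index `k`. -/
def h (k : Fin T.K) : ℝ := Metric.diam (T.cell k)

/-- The smallest element diameter. -/
def hMin : ℝ := ⨅ k : Fin T.K, T.h k

/-- The edges of a triangle are indexed by the opposite vertex; `edgeA` and `edgeB` are the two
endpoints of edge `e` of triangle `k`. -/
def edgeA (k : Fin T.K) (e : Fin 3) : Plane := (T.tri k).points (e + 1)

/-- See `edgeA`. -/
def edgeB (k : Fin T.K) (e : Fin 3) : Plane := (T.tri k).points (e + 2)

/-- The point of edge `e` of triangle `k` with parameter `t ∈ [0,1]`. -/
def edgePt (k : Fin T.K) (e : Fin 3) (t : ℝ) : Plane :=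
  AffineMap.lineMap (T.edgeA k e) (T.edgeB k e) t

/-- Integral along edge `e` of triangle `k` with respect to arc length. -/
def edgeInt (k : Fin T.K) (e : Fin 3) (g : Plane → ℝ) : ℝ :=
  dist (T.edgeA k e) (T.edgeB k e) * ∫ t in (0 : ℝ)..1, g (T.edgePt k e t)

/-- A vector orthogonal to edge `e` of triangle `k`, with the length of the edge. -/
def edgeRot (k : Fin T.K) (e : Fin 3) : Plane :=
  !₂[(T.edgeB k e - T.edgeA k e) 1, -((T.edgeB k e - T.edgeA k e) 0)]

/-- The outward unit normal of triangle `k` on its edge `e`: it points away from the opposite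
vertex. -/
def normal (k : Fin T.K) (e : Fin 3) : Plane :=
  (-(SignType.sign (inner ℝ (T.edgeRot k e) ((T.tri k).points e - T.edgeA k e)) : ℝ)
    / dist (T.edgeA k e) (T.edgeB k e)) • T.edgeRot k e

/-- Triangle `j` lies on the other side of edge `e` of triangle `k`. -/
def IsNeighbour (k : Fin T.K) (e : Fin 3) (j : Fin T.K) : Prop :=
  j ≠ k ∧ T.edgeA k e ∈ Set.range (T.tri j).points ∧ T.edgeB k e ∈ Set.range (T.tri j).points

open Classical in
/-- The neighbour of triangle `k` across its edge `e`; `none` for an edge on the outer boundary. -/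
def nbr (k : Fin T.K) (e : Fin 3) : Option (Fin T.K) :=
  if hj : ∃ j, T.IsNeighbour k e j then some hj.choose else none

/-- Scalar piecewise polynomial functions of degree at most `N` on the mesh, without any continuity
across the edges. -/
abbrev HField (N : ℕ) : Type := Fin T.K → Poly N

/-- Pairs `(E_x, E_y)` of piecewise polynomial functions. -/
abbrev EField (N : ℕ) : Type := T.HField N × T.HField N

variable {T}

/-- The `L²(Ω)` norm of a scalar piecewise polynomial function. -/
def normH {N : ℕ} (v : T.HField N) : ℝ :=
  √(∑ k, ∫ x in T.cell k, (val (v k) x) ^ 2)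

/-- The `L²(Ω)` norm of a pair of piecewise polynomial functions. -/
def normE {N : ℕ} (v : T.EField N) : ℝ := √(normH v.1 ^ 2 + normH v.2 ^ 2)

/-- The jump `[v] = v⁻ - v⁺` at a point `x` of edge `e` of triangle `k`; on the outer boundary
`[v] = v⁻`. -/
def jump {N : ℕ} (v : T.HField N) (k : Fin T.K) (e : Fin 3) (x : Plane) : ℝ :=
  match T.nbr k e with
  | some j => val (v k) x - val (v j) x
  | none => val (v k) x

/-- The tangential jump `n_x [E_y] - n_y [E_x]` at a point of edge `e` of triangle `k`. -/
def tjump {N : ℕ} (E : T.EField N) (k : Fin T.K) (e : Fin 3) (x : Plane) : ℝ :=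
  T.normal k e 0 * jump E.2 k e x - T.normal k e 1 * jump E.1 k e x

variable (T)

/-- The trace inequality for polynomials of degree at most `N`, on each edge of each triangle:
`‖u‖_{L²(f)} ≤ C √((N+1)(N+2)) h_k^{-1/2} ‖u‖_{L²(T_k)}`. -/
def EdgeTrace (N : ℕ) (C : ℝ) : Prop :=
  ∀ (k : Fin T.K) (e : Fin 3) (u : Poly N),
    √(T.edgeInt k e fun x => (val u x) ^ 2) ≤
      C * √(((N : ℝ) + 1) * ((N : ℝ) + 2)) / √(T.h k) * √(∫ x in T.cell k, (val u x) ^ 2)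

/-- The same trace inequality on the whole boundary of each triangle:
`‖u‖_{L²(∂T_k)} ≤ C √((N+1)(N+2)) h_k^{-1/2} ‖u‖_{L²(T_k)}`. -/
def BoundaryTrace (N : ℕ) (C : ℝ) : Prop :=
  ∀ (k : Fin T.K) (u : Poly N),
    √(∑ e : Fin 3, T.edgeInt k e fun x => (val u x) ^ 2) ≤
      C * √(((N : ℝ) + 1) * ((N : ℝ) + 2)) / √(T.h k) * √(∫ x in T.cell k, (val u x) ^ 2)

end TriMesh

/-- The effective permittivity `det ε / (nᵀ ε n)` in the direction `n`. -/
def effPermittivity (A : Matrix (Fin 2) (Fin 2) ℝ) (n : Plane) : ℝ :=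
  A.det / ∑ i, ∑ j, n i * A i j * n j

/-- The impedance `μ c`, where `c = 1 / √(μ ε_eff)` is the wave speed in the direction `n`. -/
def impedance (A : Matrix (Fin 2) (Fin 2) ℝ) (m : ℝ) (n : Plane) : ℝ :=
  m * (1 / √(m * effPermittivity A n))

/-- The pointwise requirements on permittivity and permeability: symmetry and two-sided bounds. -/
def AdmissibleAt (εlo εhi μlo μhi : ℝ) (A : Matrix (Fin 2) (Fin 2) ℝ) (m : ℝ) : Prop :=
  A.IsSymm ∧
  (∀ ξ : Fin 2 → ℝ, εlo * ∑ i, ξ i ^ 2 ≤ ∑ i, ∑ j, ξ i * A i j * ξ j ∧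
    ∑ i, ∑ j, ξ i * A i j * ξ j ≤ εhi * ∑ i, ξ i ^ 2) ∧
  μlo ≤ m ∧ m ≤ μhi

/-- Permittivity and permeability. `eps k` and `mu k` are the coefficients seen from triangle `k`:
inside the triangle they are the given functions, on its edges they are the one-sided traces (from
inside the triangle) that enter the numerical fluxes, so that jumps between triangles are allowed.
-/
structure Coefficients (T : TriMesh) where
  eps : Fin T.K → Plane → Matrix (Fin 2) (Fin 2) ℝ
  mu : Fin T.K → Plane → ℝ
  eps_measurable : ∀ k i j, Measurable fun x => eps k x i j
  mu_measurable : ∀ k, Measurable (mu k)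
  εlo : ℝ
  εhi : ℝ
  μlo : ℝ
  μhi : ℝ
  εlo_pos : 0 < εlo
  μlo_pos : 0 < μlo
  admissible_cell : ∀ k, ∀ᵐ x ∂(volume.restrict (T.cell k)),
    AdmissibleAt εlo εhi μlo μhi (eps k x) (mu k x)
  admissible_edge : ∀ k e, ∀ t ∈ Set.Icc (0 : ℝ) 1,
    AdmissibleAt εlo εhi μlo μhi (eps k (T.edgePt k e t)) (mu k (T.edgePt k e t))

namespace Coefficients

variable {T : TriMesh} (c : Coefficients T)

/-- The coefficients are constant on every closed triangle. -/
def CellwiseConstant : Prop :=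
  ∀ k, ∀ x ∈ T.cell k, ∀ y ∈ T.cell k, c.eps k x = c.eps k y ∧ c.mu k x = c.mu k y

/-- The impedance `Z⁻` of triangle `k` on its edge `e`. -/
def Zin (k : Fin T.K) (e : Fin 3) (x : Plane) : ℝ :=
  impedance (c.eps k x) (c.mu k x) (T.normal k e)

/-- The impedance `Z⁺` of the neighbouring triangle; `Z⁺ = Z⁻` on the outer boundary. -/
def Zout (k : Fin T.K) (e : Fin 3) (x : Plane) : ℝ :=
  match T.nbr k e with
  | some j => impedance (c.eps j x) (c.mu j x) (T.normal k e)
  | none => c.Zin k e x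

/-- The conductance `Y⁻ = 1 / Z⁻`. -/
def Yin (k : Fin T.K) (e : Fin 3) (x : Plane) : ℝ := (c.Zin k e x)⁻¹

/-- The conductance `Y⁺ = 1 / Z⁺`. -/
def Yout (k : Fin T.K) (e : Fin 3) (x : Plane) : ℝ := (c.Zout k e x)⁻¹

/-- The smallest cell impedance. -/
def minZ : ℝ :=
  ⨅ p : Fin T.K × Fin 3 × Set.Icc (0 : ℝ) 1, c.Zin p.1 p.2.1 (T.edgePt p.1 p.2.1 p.2.2)

/-- The smallest cell conductance. -/
def minY : ℝ :=
  ⨅ p : Fin T.K × Fin 3 × Set.Icc (0 : ℝ) 1, c.Yin p.1 p.2.1 (T.edgePt p.1 p.2.1 p.2.2)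

/-- The constant `C_E` of the stability condition. -/
def CE (N : ℕ) (α Cτ Cinv : ℝ) : ℝ :=
  1 / 2 * Cinv * (N : ℝ) ^ 2
    + Cτ ^ 2 * ((N : ℝ) + 1) * ((N : ℝ) + 2) * (5 / 2 + (α + 1 / 4) / c.minZ)

/-- The constant `C_H` of the stability condition. -/
def CH (N : ℕ) (α Cτ Cinv : ℝ) : ℝ :=
  1 / 2 * Cinv * (N : ℝ) ^ 2
    + Cτ ^ 2 * ((N : ℝ) + 1) * ((N : ℝ) + 2) * (5 / 2 + (α + 1 / 2) / c.minY)

end Coefficients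

/-- The flux parameter on edge `e` of triangle `k`: `α` inside, `1` on the outer boundary. -/
def fluxParam {T : TriMesh} (α : ℝ) (k : Fin T.K) (e : Fin 3) : ℝ :=
  match T.nbr k e with
  | some _ => α
  | none => 1

section Scheme

variable {T : TriMesh} (c : Coefficients T) {N : ℕ} (α Δt : ℝ)

/-- The flux expression `(Z⁺ [H] - α (n_x [E_y] - n_y [E_x])) / (Z⁺ + Z⁻)` on edge `e` of
triangle `k`. -/
def fluxE (E : T.EField N) (H : T.HField N) (k : Fin T.K) (e : Fin 3) (x : Plane) : ℝ :=
  1 / (c.Zout k e x + c.Zin k e x) *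
    (c.Zout k e x * TriMesh.jump H k e x - fluxParam α k e * TriMesh.tjump E k e x)

/-- The flux expression `(Y⁺ (n_x [E_y] - n_y [E_x]) - α [H]) / (Y⁺ + Y⁻)` on edge `e` of
triangle `k`. -/
def fluxH (E : T.EField N) (H : T.HField N) (k : Fin T.K) (e : Fin 3) (x : Plane) : ℝ :=
  1 / (c.Yout k e x + c.Yin k e x) *
    (c.Yout k e x * TriMesh.tjump E k e x - fluxParam α k e * TriMesh.jump H k e x)

/-- The two electric equations of a time step. Here `E` is the electric field at the old integer
time, `H` the magnetic field at the old half-integer time, `P` the approximation of the new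
electric field that enters the averaged flux, and `E'` the new electric field. The explicit inner
iteration takes for `P` the previous iterate; the implicit method takes `P = E'`. -/
def EStep (E : T.EField N) (H : T.HField N) (P E' : T.EField N) : Prop :=
  (∀ (k : Fin T.K) (u : Poly N),
    ∫ x in T.cell k,
        (c.eps k x 0 0 * ((val (E'.1 k) x - val (E.1 k) x) / Δt)
          + c.eps k x 0 1 * ((val (E'.2 k) x - val (E.2 k) x) / Δt)) * val u x =
      (∫ x in T.cell k, val (MvPolynomial.pderiv 1 (H k : MvPolynomial (Fin 2) ℝ)) x * val u x)
      + ∑ e : Fin 3, T.edgeInt k e fun x =>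
          -(T.normal k e 1) * fluxE c α ((1 / 2 : ℝ) • (E + P)) H k e x * val u x) ∧
  (∀ (k : Fin T.K) (v : Poly N),
    ∫ x in T.cell k,
        (c.eps k x 1 0 * ((val (E'.1 k) x - val (E.1 k) x) / Δt)
          + c.eps k x 1 1 * ((val (E'.2 k) x - val (E.2 k) x) / Δt)) * val v x =
      -(∫ x in T.cell k, val (MvPolynomial.pderiv 0 (H k : MvPolynomial (Fin 2) ℝ)) x * val v x)
      + ∑ e : Fin 3, T.edgeInt k e fun x =>
          T.normal k e 0 * fluxE c α ((1 / 2 : ℝ) • (E + P)) H k e x * val v x)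

/-- The magnetic equation of a time step. Here `E` is the electric field at the new integer time,
`H` the magnetic field at the old half-integer time, `P` the approximation of the new magnetic
field that enters the averaged flux, and `H'` the new magnetic field. -/
def HStep (E : T.EField N) (H P H' : T.HField N) : Prop :=
  ∀ (k : Fin T.K) (w : Poly N),
    ∫ x in T.cell k, c.mu k x * ((val (H' k) x - val (H k) x) / Δt) * val w x =
      (∫ x in T.cell k,
        (val (MvPolynomial.pderiv 1 (E.1 k : MvPolynomial (Fin 2) ℝ)) x
          - val (MvPolynomial.pderiv 0 (E.2 k : MvPolynomial (Fin 2) ℝ)) x) * val w x)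
      + ∑ e : Fin 3, T.edgeInt k e fun x =>
          fluxH c α E ((1 / 2 : ℝ) • (H + P)) k e x * val w x

/-- One time step of the implicit method, from `(E, H)` to `(E', H')`. -/
def ImplicitStep (E : T.EField N) (H : T.HField N) (E' : T.EField N) (H' : T.HField N) : Prop :=
  EStep c α Δt E H E' E' ∧ HStep c α Δt E' H H' H'

/-- A solution of the implicit method over `M` time steps. `E m` is the electric field at time
`m Δt`, `H m` the magnetic field at time `(m + 1/2) Δt`. -/
def IsImplicitSolution (M : ℕ) (E₀ : T.EField N) (H₀ : T.HField N)
    (E : ℕ → T.EField N) (H : ℕ → T.HField N) : Prop :=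
  E 0 = E₀ ∧ H 0 = H₀ ∧ ∀ m < M, ImplicitStep c α Δt (E m) (H m) (E (m + 1)) (H (m + 1))

/-- The inner iterates of one time step from `(E, H)`. `X n` is the field that the magnetic
equation uses, in the passage from iterate `n` to iterate `n + 1`, as electric field at the new
time. -/
def IsInnerIteration (E : T.EField N) (H : T.HField N) (X : ℕ → T.EField N)
    (Eit : ℕ → T.EField N) (Hit : ℕ → T.HField N) : Prop :=
  Eit 0 = E ∧ Hit 0 = H ∧
  ∀ n, EStep c α Δt E H (Eit n) (Eit (n + 1)) ∧ HStep c α Δt (X n) H (Hit n) (Hit (n + 1))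

/-- A run of the iterative method over `M` time steps, with `ν m` inner iterations in the step from
`m` to `m + 1`: the field accepted at the new time is the iterate with number `ν m`, and the
magnetic equation uses the accepted electric field. -/
def IsIterativeRun (M : ℕ) (ν : ℕ → ℕ) (E₀ : T.EField N) (H₀ : T.HField N)
    (E : ℕ → T.EField N) (H : ℕ → T.HField N) : Prop :=
  E 0 = E₀ ∧ H 0 = H₀ ∧ ∀ m < M, ∃ (Eit : ℕ → T.EField N) (Hit : ℕ → T.HField N),
    IsInnerIteration c α Δt (E m) (H m) (fun _ => E (m + 1)) Eit Hit ∧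
    E (m + 1) = Eit (ν m) ∧ H (m + 1) = Hit (ν m)

end Scheme

end MaxwellDG

end

/-! The new field enters the right-hand side of an update only through the penalty part of the flux,
the jump multiplied by α (by 1 on the outer boundary). Summed over the cells, an update reads a(E' -
E, w) = Δt d(H, w) + (Δt/2) b(E + P, w). Here a is the mass form weighted by ε or μ, an inner
product on the finite-dimensional discrete space, d collects the derivatives and the flux terms of
the other, known field, and b is the penalty form (`eStep_iff`, `hStep_iff`). With the Riesz map Φ
of a, the update is explicit in E' and depends on P through the linear map G = (Δt/2) Φ b.
Convergence of the inner iteration and solvability of the implicit step both follow once G contracts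
in the energy norm. The coupling is triangular: the electric equation is solved by itself, and the
magnetic one then sees the electric error as a perturbation of its data (`coupled_iteration`).

For the contraction, let X(v) be the sum over all edges of the squared inner traces divided by the
weight (Z for E, Y for H). Every outer trace is an inner trace of a neighbour, and conformity
ensures that no inner trace is used twice (`SameEdge.unique`, `sum_outer_trace_le`). This gives
|b(x, y)| ≤ (1+3α)/4 X(x) + (1+α)/4 X(y). If Δt X(v) ≤ r a(v, v), then y = Gx tested with itself
satisfies a(y, y) ≤ r(1+3α)/8 a(x, x) + r(1+α)/8 a(y, y), which is a contraction when r < 4/(1+2α)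
(`exists_contraction`).

The time step restriction supplies r. Write D = C_τ²(N+1)(N+2), and h for the smallest diameter. For
cellwise constant coefficients, the pointwise bound of ε_eff times the squared tangential component
by EᵀεE, together with √(μ ε_eff) ≥ min(ε, μ), gives r = 3 Δt D / (min(ε, μ) h), and the summand 5/2
makes this less than 6/5. In general the trace inequality on the whole boundary gives r = Δt D /
(min Z · ε h) for E and its analogue with Y, μ for H, controlled by the summands with α + 1/4 and α
+ 1/2. In these formulas ε, μ stand for the lower bounds.

Over several time steps, the iterates depend continuously on the data, uniformly in large iteration
numbers (`iterate_near_fixedPoint`), so tolerances can be passed back from one time step to the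
previous one. -/

noncomputable section

namespace MaxwellDG

/-! ### Affine fixed point iterations with a contracting linear part -/

section Contraction

lemma le_of_contracting_recursion {a s : ℕ → ℝ} {q σ : ℝ} (hq0 : 0 ≤ q)
    (h : ∀ n, a (n + 1) ≤ q * a n + s n) (hs : ∀ n, s n ≤ (1 - q) * σ) (hσ : 0 ≤ σ) (n : ℕ) :
    a n ≤ q ^ n * a 0 + σ := by
  induction n with
  | zero => simpa using hσ
  | succ n ih =>
    calc a (n + 1) ≤ q * a n + s n := h n
      _ ≤ q * (q ^ n * a 0 + σ) + (1 - q) * σ :=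
        add_le_add (mul_le_mul_of_nonneg_left ih hq0) (hs n)
      _ = q ^ (n + 1) * a 0 + σ := by ring

/-- Once the source is below (1 - q)ε/2, it contributes at most ε/2 in total and the rest decays
geometrically. The source is needed for the magnetic iteration driven by unconverged electric
iterates. -/
lemma tendsto_zero_of_contracting_recursion {a s : ℕ → ℝ} {q : ℝ} (hq0 : 0 ≤ q) (hq1 : q < 1)
    (ha : ∀ n, 0 ≤ a n) (h : ∀ n, a (n + 1) ≤ q * a n + s n)
    (hs : Tendsto s atTop (𝓝 0)) : Tendsto a atTop (𝓝 0) := by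
  rw [Metric.tendsto_atTop]
  intro ε hε
  have hσ : 0 < (1 - q) * (ε / 2) := mul_pos (by linarith) (by linarith)
  obtain ⟨n₁, hn₁⟩ := (Metric.tendsto_atTop.1 hs) _ hσ
  have hb : ∀ n, a (n₁ + n) ≤ q ^ n * a n₁ + ε / 2 := by
    intro n
    refine le_of_contracting_recursion (a := fun n => a (n₁ + n)) (s := fun n => s (n₁ + n))
      hq0 (fun n => h (n₁ + n)) (fun n => ?_) (by linarith) n
    have := hn₁ (n₁ + n) (by omega)
    rw [Real.dist_eq, sub_zero] at this
    exact (le_abs_self _).trans this.le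
  have ht : Tendsto (fun n => q ^ n * a n₁) atTop (𝓝 0) := by
    simpa using (tendsto_pow_atTop_nhds_zero_of_lt_one hq0 hq1).mul_const (a n₁)
  obtain ⟨n₂, hn₂⟩ := (Metric.tendsto_atTop.1 ht) (ε / 2) (by linarith)
  refine ⟨n₁ + n₂, fun n hn => ?_⟩
  obtain ⟨k, rfl⟩ := Nat.exists_eq_add_of_le (show n₁ ≤ n by omega)
  have h1 := hn₂ k (by omega)
  rw [Real.dist_eq, sub_zero] at h1 ⊢
  rw [abs_of_nonneg (ha _)]
  linarith [hb k, le_abs_self (q ^ k * a n₁)]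

variable {V : Type*} [NormedAddCommGroup V] [NormedSpace ℝ V]

/-- A vector with x = G x must vanish, so id - G is injective and, in finite dimension, invertible.
Taking S as its inverse makes the solution of the implicit equation linear in the data. -/
lemma existsUnique_fixedPoint [FiniteDimensional ℝ V] {G : V →ₗ[ℝ] V} {q : ℝ} (hq1 : q < 1)
    (hG : ∀ x, ‖G x‖ ≤ q * ‖x‖) : ∃ S : V →ₗ[ℝ] V, ∀ b x, x = b + G x ↔ x = S b := by
  have hinj : Function.Injective (LinearMap.id - G : V →ₗ[ℝ] V) := by
    rw [← LinearMap.ker_eq_bot, LinearMap.ker_eq_bot']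
    intro x hx
    have hx' : x = G x := by simpa [sub_eq_zero] using hx
    by_contra hne
    have := hG x
    rw [← hx'] at this
    nlinarith [norm_pos_iff.2 hne]
  let e := LinearEquiv.ofInjectiveEndo (LinearMap.id - G : V →ₗ[ℝ] V) hinj
  refine ⟨e.symm, fun b x => ?_⟩
  have he : e x = x - G x := rfl
  rw [← sub_eq_iff_eq_add, ← he]
  exact e.eq_symm_apply.symm

variable {U : Type*} [NormedAddCommGroup U] [NormedSpace ℝ U] [FiniteDimensional ℝ U]

lemma exists_norm_le_of_finiteDimensional (F : U →ₗ[ℝ] V) : ∃ C > 0, ∀ u, ‖F u‖ ≤ C * ‖u‖ := by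
  obtain ⟨C, hC, h⟩ := (LinearMap.toContinuousLinearMap F).isBoundedLinearMap.bound
  exact ⟨C, hC, h⟩

/-- The iterates of a contracting affine map are close to the fixed point as soon as the data are
close to the data of the fixed point and the number of iterations is large. -/
lemma iterate_near_fixedPoint {G : V →ₗ[ℝ] V} {q : ℝ} (hq0 : 0 ≤ q) (hq1 : q < 1)
    (hG : ∀ x, ‖G x‖ ≤ q * ‖x‖) (F I : U →ₗ[ℝ] V) (u₀ : U) (x₀ : V) (hx₀ : x₀ = F u₀ + G x₀)
    {δ : ℝ} (hδ : 0 < δ) :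
    ∃ n₀ : ℕ, ∃ η > 0, ∀ u, ‖u - u₀‖ < η → ∀ y : ℕ → V, y 0 = I u →
      (∀ n, y (n + 1) = F u + G (y n)) → ∀ n ≥ n₀, ‖y n - x₀‖ < δ := by
  obtain ⟨C, hC, hF⟩ := exists_norm_le_of_finiteDimensional F
  obtain ⟨C', hC', hI⟩ := exists_norm_le_of_finiteDimensional I
  have hq : 0 < 1 - q := by linarith
  have ht : Tendsto (fun n => q ^ n * (C' + ‖I u₀ - x₀‖)) atTop (𝓝 0) := by
    simpa using (tendsto_pow_atTop_nhds_zero_of_lt_one hq0 hq1).mul_const (C' + ‖I u₀ - x₀‖)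
  obtain ⟨n₀, hn₀⟩ := (Metric.tendsto_atTop.1 ht) (δ / 2) (by linarith)
  -- The bound 1 controls the starting error uniformly in u, so that n₀ can be fixed before u. The
  -- other bound keeps the accumulated perturbation C‖u - u₀‖/(1 - q) below δ/2.
  refine ⟨n₀, min 1 ((1 - q) * (δ / 2) / C), by positivity, ?_⟩
  intro u hu y hy0 hy n hn
  have hu1 : ‖u - u₀‖ < 1 := hu.trans_le (min_le_left _ _)
  have hu2 : C * ‖u - u₀‖ ≤ (1 - q) * (δ / 2) := by
    have := (hu.trans_le (min_le_right _ _)).le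
    rwa [le_div_iff₀ hC, mul_comm] at this
  have hrec : ∀ n, ‖y (n + 1) - x₀‖ ≤ q * ‖y n - x₀‖ + C * ‖u - u₀‖ := by
    intro n
    have : y (n + 1) - x₀ = G (y n - x₀) + F (u - u₀) := by
      rw [hy n, map_sub, map_sub]
      nth_rewrite 1 [hx₀]
      abel
    rw [this]
    exact (norm_add_le _ _).trans (add_le_add (hG _) (hF _))
  have h0 : ‖y 0 - x₀‖ ≤ C' + ‖I u₀ - x₀‖ := by
    have : y 0 - x₀ = I (u - u₀) + (I u₀ - x₀) := by rw [hy0, map_sub]; abel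
    rw [this]
    refine (norm_add_le _ _).trans (add_le_add ((hI _).trans ?_) le_rfl)
    nlinarith
  have h1 := le_of_contracting_recursion (a := fun n => ‖y n - x₀‖) hq0 hrec
    (fun _ => hu2) (by linarith) n
  have h2 := hn₀ n hn
  rw [Real.dist_eq, sub_zero] at h2
  have h3 : q ^ n * ‖y 0 - x₀‖ ≤ q ^ n * (C' + ‖I u₀ - x₀‖) :=
    mul_le_mul_of_nonneg_left h0 (by positivity)
  have h4 := le_abs_self (q ^ n * (C' + ‖I u₀ - x₀‖))
  linarith

end Contraction

/-! ### A pair of coupled implicit steps -/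

section Coupled

variable {V W : Type*} [NormedAddCommGroup V] [NormedSpace ℝ V] [FiniteDimensional ℝ V]
  [NormedAddCommGroup W] [NormedSpace ℝ W] [FiniteDimensional ℝ W]

/-- Well-posedness of the implicit scheme and convergence of the inner iteration, for an abstract
pair of affine updates whose implicit parts contract. -/
theorem coupled_iteration_of_norm
    {ES : V → W → V → V → Prop} {HS : V → W → W → W → Prop}
    {R : W →ₗ[ℝ] V} {G : V →ₗ[ℝ] V} {R' : V →ₗ[ℝ] W} {G' : W →ₗ[ℝ] W} {q q' : ℝ}
    (hES : ∀ E H P E', ES E H P E' ↔ E' = E + R H + G (E + P))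
    (hHS : ∀ E H P H', HS E H P H' ↔ H' = H + R' E + G' (H + P))
    (hq0 : 0 ≤ q) (hq1 : q < 1) (hG : ∀ x, ‖G x‖ ≤ q * ‖x‖)
    (hq0' : 0 ≤ q') (hq1' : q' < 1) (hG' : ∀ x, ‖G' x‖ ≤ q' * ‖x‖)
    {pV : V → ℝ} {pW : W → ℝ} {C : ℝ} (hC : 0 < C)
    (hpV0 : ∀ x, 0 ≤ pV x) (hpV : ∀ x, pV x ≤ C * ‖x‖)
    (hpW0 : ∀ x, 0 ≤ pW x) (hpW : ∀ x, pW x ≤ C * ‖x‖) (M : ℕ) :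
    ((∀ (E : V) (H : W) (P : V), ∃! E' : V, ES E H P E') ∧
      (∀ (E : V) (H P : W), ∃! H' : W, HS E H P H')) ∧
    (∀ (E : V) (H : W), ∃ (E' : V) (H' : W), (ES E H E' E' ∧ HS E' H H' H') ∧
      (∀ (E'' : V) (H'' : W), (ES E H E'' E'' ∧ HS E'' H H'' H'') → E'' = E' ∧ H'' = H') ∧
      ∀ (X Eit : ℕ → V) (Hit : ℕ → W),
        ((∀ n, X n = E') ∨ (∀ n, X n = Eit (n + 1))) →
        (Eit 0 = E ∧ Hit 0 = H ∧
          ∀ n, ES E H (Eit n) (Eit (n + 1)) ∧ HS (X n) H (Hit n) (Hit (n + 1))) →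
        Tendsto (fun n => pV (Eit n - E')) atTop (𝓝 0) ∧
        Tendsto (fun n => pW (Hit n - H')) atTop (𝓝 0)) ∧
    (∀ (E₀ : V) (H₀ : W), ∃ (E : ℕ → V) (H : ℕ → W),
      (E 0 = E₀ ∧ H 0 = H₀ ∧ ∀ m < M, ES (E m) (H m) (E (m + 1)) (E (m + 1)) ∧
        HS (E (m + 1)) (H m) (H (m + 1)) (H (m + 1))) ∧
      (∀ (E' : ℕ → V) (H' : ℕ → W),
        (E' 0 = E₀ ∧ H' 0 = H₀ ∧ ∀ m < M, ES (E' m) (H' m) (E' (m + 1)) (E' (m + 1)) ∧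
          HS (E' (m + 1)) (H' m) (H' (m + 1)) (H' (m + 1))) →
        ∀ m ≤ M, E' m = E m ∧ H' m = H m) ∧
      ∀ δ > (0 : ℝ), ∃ n₀ : ℕ, ∀ ν : ℕ → ℕ, (∀ m < M, n₀ ≤ ν m) →
        ∀ (E' : ℕ → V) (H' : ℕ → W),
          (E' 0 = E₀ ∧ H' 0 = H₀ ∧ ∀ m < M, ∃ (Eit : ℕ → V) (Hit : ℕ → W),
            (Eit 0 = E' m ∧ Hit 0 = H' m ∧ ∀ n, ES (E' m) (H' m) (Eit n) (Eit (n + 1)) ∧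
              HS (E' (m + 1)) (H' m) (Hit n) (Hit (n + 1))) ∧
            E' (m + 1) = Eit (ν m) ∧ H' (m + 1) = Hit (ν m)) →
          ∀ m ≤ M, pV (E' m - E m) < δ ∧ pW (H' m - H m) < δ) := by
  obtain ⟨S, hS⟩ := existsUnique_fixedPoint hq1 hG
  obtain ⟨S', hS'⟩ := existsUnique_fixedPoint hq1' hG'
  -- The known half of the averaged flux, G E, is counted among the data, so that only G P is
  -- iterated.
  let F : V × W →ₗ[ℝ] V := LinearMap.coprod (LinearMap.id + G) R
  let F' : V × W →ₗ[ℝ] W := LinearMap.coprod R' (LinearMap.id + G')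
  have hES' : ∀ E H P E', ES E H P E' ↔ E' = F (E, H) + G P := by
    intro E H P E'
    rw [hES, show F (E, H) + G P = E + R H + G (E + P) by simp [F]; abel]
  have hHS' : ∀ E H P H', HS E H P H' ↔ H' = F' (E, H) + G' P := by
    intro E H P H'
    rw [hHS, show F' (E, H) + G' P = H + R' E + G' (H + P) by simp [F']; abel]
  have himp : ∀ E H E' H', (ES E H E' E' ∧ HS E' H H' H') ↔
      (E' = S (F (E, H)) ∧ H' = S' (F' (E', H))) := by
    intro E H E' H'
    rw [hES', hHS', hS, hS']
  refine ⟨⟨fun E H P => ⟨_, (hES E H P _).2 rfl, fun y hy => (hES E H P y).1 hy⟩,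
    fun E H P => ⟨_, (hHS E H P _).2 rfl, fun y hy => (hHS E H P y).1 hy⟩⟩, ?_, ?_⟩
  · intro E H
    set E' := S (F (E, H)) with hE'
    set H' := S' (F' (E', H)) with hH'
    refine ⟨E', H', (himp _ _ _ _).2 ⟨rfl, rfl⟩, ?_, ?_⟩
    · intro E'' H'' h
      obtain ⟨h1, h2⟩ := (himp _ _ _ _).1 h
      rw [h1] at h2
      exact ⟨h1, h2⟩
    · rintro X Eit Hit hX ⟨-, -, hit⟩
      have hEfix : E' = F (E, H) + G E' := (hS _ _).2 rfl
      have hHfix : H' = F' (E', H) + G' H' := (hS' _ _).2 rfl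
      have hE : Tendsto (fun n => ‖Eit n - E'‖) atTop (𝓝 0) := by
        refine tendsto_zero_of_contracting_recursion (s := fun _ => 0) hq0 hq1
          (fun n => norm_nonneg _) (fun n => ?_) tendsto_const_nhds
        have h1 := (hES' _ _ _ _).1 (hit n).1
        have : Eit (n + 1) - E' = G (Eit n - E') := by
          rw [h1, map_sub]
          nth_rewrite 1 [hEfix]
          abel
        rw [this, add_zero]
        exact hG _
      have hXt : Tendsto (fun n => ‖X n - E'‖) atTop (𝓝 0) := by
        rcases hX with hX | hX
        · simp [hX]
        · simp only [hX]
          exact hE.comp (tendsto_add_atTop_nat 1)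
      obtain ⟨CR, -, hR⟩ := exists_norm_le_of_finiteDimensional R'
      -- The magnetic error obeys a contracting recursion with the electric error X n - E' as
      -- source, and this source vanishes in the limit for both admissible choices of X.
      have hH : Tendsto (fun n => ‖Hit n - H'‖) atTop (𝓝 0) := by
        refine tendsto_zero_of_contracting_recursion (s := fun n => CR * ‖X n - E'‖) hq0' hq1'
          (fun n => norm_nonneg _) (fun n => ?_) (by simpa using hXt.const_mul CR)
        have h1 := (hHS _ _ _ _).1 (hit n).2
        have h2 := (hHS E' H H' H').1 ((hHS' _ _ _ _).2 hHfix)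
        have : Hit (n + 1) - H' = G' (Hit n - H') + R' (X n - E') := by
          rw [h1, map_sub, map_sub, map_add]
          nth_rewrite 1 [h2]
          rw [map_add]
          abel
        rw [this]
        exact (norm_add_le _ _).trans (add_le_add (hG' _) (hR _))
      exact ⟨squeeze_zero (fun n => hpV0 _) (fun n => hpV _) (by simpa using hE.const_mul C),
        squeeze_zero (fun n => hpW0 _) (fun n => hpW _) (by simpa using hH.const_mul C)⟩
  · intro E₀ H₀
    let step : V × W → V × W := fun u =>
      (S (F u), S' (F' (S (F u), u.2)))
    let u : ℕ → V × W := fun m => step^[m] (E₀, H₀)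
    have hu : ∀ m, u (m + 1) = step (u m) := fun m => Function.iterate_succ_apply' _ _ _
    have hu1 : ∀ m, (u (m + 1)).1 = S (F (u m)) := fun m => by rw [hu]
    have hu2 : ∀ m, (u (m + 1)).2 = S' (F' ((u (m + 1)).1, (u m).2)) := fun m => by rw [hu]
    refine ⟨fun m => (u m).1, fun m => (u m).2, ⟨rfl, rfl, fun m _ => (himp _ _ _ _).2
      ⟨hu1 m, hu2 m⟩⟩, ?_, ?_⟩
    · rintro E' H' ⟨h0, h0', hstep⟩ m
      induction m with
      | zero => exact fun _ => ⟨h0, h0'⟩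
      | succ m ih =>
        intro hm
        obtain ⟨i1, i2⟩ := ih (by omega)
        obtain ⟨j1, j2⟩ := (himp _ _ _ _).1 (hstep m (by omega))
        rw [i1, i2] at j1
        have k1 : E' (m + 1) = (u (m + 1)).1 := j1.trans (hu1 m).symm
        rw [k1, i2] at j2
        exact ⟨k1, j2.trans (hu2 m).symm⟩
    · have key : ∀ m ≤ M, ∀ δ > (0 : ℝ), ∃ n₀ : ℕ, ∀ ν : ℕ → ℕ, (∀ m < M, n₀ ≤ ν m) →
          ∀ (E' : ℕ → V) (H' : ℕ → W),
          (E' 0 = E₀ ∧ H' 0 = H₀ ∧ ∀ m < M, ∃ (Eit : ℕ → V) (Hit : ℕ → W),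
            (Eit 0 = E' m ∧ Hit 0 = H' m ∧ ∀ n, ES (E' m) (H' m) (Eit n) (Eit (n + 1)) ∧
              HS (E' (m + 1)) (H' m) (Hit n) (Hit (n + 1))) ∧
            E' (m + 1) = Eit (ν m) ∧ H' (m + 1) = Hit (ν m)) →
          ‖E' m - (u m).1‖ < δ ∧ ‖H' m - (u m).2‖ < δ := by
        intro m
        induction m with
        | zero =>
          rintro - δ hδ
          refine ⟨0, fun ν _ E' H' h => ?_⟩
          rw [h.1, h.2.1]
          simpa [u] using hδ
        | succ m ih =>
          intro hm δ hδ
          -- Tolerances are chosen backwards. The magnetic substep asks for data within η₂; these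
          -- include the accepted new electric field, so the electric substep must reach min δ η₂,
          -- for which it asks for data within η₁; the previous time step must meet both η₁ and η₂.
          obtain ⟨n₂, η₂, hη₂, h₂⟩ := iterate_near_fixedPoint hq0' hq1' hG' F'
            (LinearMap.snd ℝ V W) ((u (m + 1)).1, (u m).2) (u (m + 1)).2
            ((hS' _ _).2 (hu2 m)) hδ
          obtain ⟨n₁, η₁, hη₁, h₁⟩ := iterate_near_fixedPoint hq0 hq1 hG F
            (LinearMap.fst ℝ V W) (u m) (u (m + 1)).1
            ((hS _ _).2 (hu1 m)) (lt_min hδ hη₂)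
          obtain ⟨n₃, h₃⟩ := ih (by omega) (min η₁ η₂) (lt_min hη₁ hη₂)
          refine ⟨max n₃ (max n₁ n₂), fun ν hν E' H' hrun => ?_⟩
          have h₃' := h₃ ν (fun i hi => (le_max_left _ _).trans (hν i hi)) E' H' hrun
          obtain ⟨Eit, Hit, ⟨e0, e1, hit⟩, eE, eH⟩ := hrun.2.2 m (by omega)
          have hνm := hν m (by omega)
          have hE : ‖E' (m + 1) - (u (m + 1)).1‖ < min δ η₂ := by
            rw [eE]
            refine h₁ (E' m, H' m) ?_ Eit e0 (fun n => (hES' _ _ _ _).1 (hit n).1) _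
              ((le_max_left _ _).trans ((le_max_right _ _).trans hνm))
            exact max_lt (h₃'.1.trans_le (min_le_left _ _)) (h₃'.2.trans_le (min_le_left _ _))
          refine ⟨hE.trans_le (min_le_left _ _), ?_⟩
          rw [eH]
          refine h₂ (E' (m + 1), H' m) ?_ Hit e1 (fun n => (hHS' _ _ _ _).1 (hit n).2) _
            ((le_max_right _ _).trans ((le_max_right _ _).trans hνm))
          exact max_lt (hE.trans_le (min_le_right _ _)) (h₃'.2.trans_le (min_le_right _ _))
      intro δ hδ
      choose! n₀ hn₀ using fun m hm => key m hm (δ / C) (div_pos hδ hC)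
      refine ⟨(Finset.range (M + 1)).sup n₀, fun ν hν E' H' hrun m hm => ?_⟩
      obtain ⟨h1, h2⟩ := hn₀ m hm ν (fun i hi => (Finset.le_sup (f := n₀)
        (Finset.mem_range.2 (by omega : m < M + 1))).trans (hν i hi)) E' H' hrun
      rw [lt_div_iff₀ hC] at h1 h2
      exact ⟨(hpV _).trans_lt (by linarith), (hpW _).trans_lt (by linarith)⟩

end Coupled

/-! ### Variational updates and the energy norm -/

section Energy

/-- Positivity on the diagonal makes x ↦ a x injective into the dual, which has the same dimension.
-/
lemma exists_riesz {V : Type*} [AddCommGroup V] [Module ℝ V] [FiniteDimensional ℝ V]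
    (a : V →ₗ[ℝ] V →ₗ[ℝ] ℝ) (hpos : ∀ x, x ≠ 0 → 0 < a x x) :
    ∃ Φ : Module.Dual ℝ V →ₗ[ℝ] V, ∀ (ℓ : Module.Dual ℝ V) y, (∀ w, a y w = ℓ w) ↔ y = Φ ℓ := by
  have hinj : Function.Injective a := by
    rw [← LinearMap.ker_eq_bot, LinearMap.ker_eq_bot']
    intro x hx
    by_contra hne
    have := hpos x hne
    rw [hx] at this
    simp at this
  let e : V ≃ₗ[ℝ] Module.Dual ℝ V :=
    LinearMap.linearEquivOfInjective a hinj Subspace.dual_finrank_eq.symm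
  refine ⟨e.symm, fun ℓ y => ?_⟩
  rw [LinearEquiv.coe_coe, LinearEquiv.eq_symm_apply]
  have : e y = a y := rfl
  rw [this, LinearMap.ext_iff]

/-- The inner product space core of a symmetric positive definite bilinear form. -/
abbrev energyCore {V : Type*} [AddCommGroup V] [Module ℝ V]
    (a : V →ₗ[ℝ] V →ₗ[ℝ] ℝ) (hsymm : ∀ x y, a x y = a y x) (hpos : ∀ x, x ≠ 0 → 0 < a x x) :
    InnerProductSpace.Core ℝ V where
  inner x y := a x y
  conj_inner_symm x y := hsymm y x
  re_inner_nonneg x := by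
    by_cases hx : x = 0
    · simp [hx]
    · exact (hpos x hx).le
  add_left x y z := by simp
  smul_left x y r := by simp
  definite x hx := by
    by_contra hne
    exact (hpos x hne).ne' hx

/-- The vector y = Φ (b x) tested with itself satisfies a y y = b x y. The contraction of Φ ∘ b is
thereby reduced to an estimate of the form b at such pairs. -/
lemma contracting_riesz {V : Type*} [AddCommGroup V] [Module ℝ V]
    (a b : V →ₗ[ℝ] V →ₗ[ℝ] ℝ)
    {ρ : ℝ} (hρ : 0 ≤ ρ) (hb : ∀ x y, a y y = b x y → a y y ≤ ρ * a x x)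
    {Φ : Module.Dual ℝ V →ₗ[ℝ] V} (hΦ : ∀ (ℓ : Module.Dual ℝ V) y, (∀ w, a y w = ℓ w) ↔ y = Φ ℓ)
    (x : V) : √(a (Φ (b x)) (Φ (b x))) ≤ √ρ * √(a x x) := by
  have h := hb x (Φ (b x)) ((hΦ (b x) _).2 rfl _)
  rw [← Real.sqrt_mul hρ]
  exact Real.sqrt_le_sqrt h

/-- Well-posedness of the implicit scheme and convergence of the inner iteration, for a pair of
variational updates whose implicit parts contract in the energy. -/
theorem coupled_iteration {V W : Type*} [AddCommGroup V] [Module ℝ V] [FiniteDimensional ℝ V]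
    [AddCommGroup W] [Module ℝ W] [FiniteDimensional ℝ W]
    {ES : V → W → V → V → Prop} {HS : V → W → W → W → Prop}
    {a b : V →ₗ[ℝ] V →ₗ[ℝ] ℝ} {d : W →ₗ[ℝ] V →ₗ[ℝ] ℝ}
    {a' b' : W →ₗ[ℝ] W →ₗ[ℝ] ℝ} {d' : V →ₗ[ℝ] W →ₗ[ℝ] ℝ}
    (hsymm : ∀ x y, a x y = a y x) (hpos : ∀ x, x ≠ 0 → 0 < a x x)
    (hsymm' : ∀ x y, a' x y = a' y x) (hpos' : ∀ x, x ≠ 0 → 0 < a' x x)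
    (hES : ∀ E H P E', ES E H P E' ↔ ∀ w, a (E' - E) w = d H w + b (E + P) w)
    (hHS : ∀ E H P H', HS E H P H' ↔ ∀ w, a' (H' - H) w = d' E w + b' (H + P) w)
    {ρ : ℝ} (hρ0 : 0 ≤ ρ) (hρ1 : ρ < 1) (hb : ∀ x y, a y y = b x y → a y y ≤ ρ * a x x)
    {ρ' : ℝ} (hρ0' : 0 ≤ ρ') (hρ1' : ρ' < 1) (hb' : ∀ x y, a' y y = b' x y → a' y y ≤ ρ' * a' x x)
    {pV : V → ℝ} {pW : W → ℝ} {C : ℝ} (hC : 0 < C)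
    (hpV0 : ∀ x, 0 ≤ pV x) (hpV : ∀ x, pV x ≤ C * √(a x x))
    (hpW0 : ∀ x, 0 ≤ pW x) (hpW : ∀ x, pW x ≤ C * √(a' x x)) (M : ℕ) :
    ((∀ (E : V) (H : W) (P : V), ∃! E' : V, ES E H P E') ∧
      (∀ (E : V) (H P : W), ∃! H' : W, HS E H P H')) ∧
    (∀ (E : V) (H : W), ∃ (E' : V) (H' : W), (ES E H E' E' ∧ HS E' H H' H') ∧
      (∀ (E'' : V) (H'' : W), (ES E H E'' E'' ∧ HS E'' H H'' H'') → E'' = E' ∧ H'' = H') ∧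
      ∀ (X Eit : ℕ → V) (Hit : ℕ → W),
        ((∀ n, X n = E') ∨ (∀ n, X n = Eit (n + 1))) →
        (Eit 0 = E ∧ Hit 0 = H ∧
          ∀ n, ES E H (Eit n) (Eit (n + 1)) ∧ HS (X n) H (Hit n) (Hit (n + 1))) →
        Tendsto (fun n => pV (Eit n - E')) atTop (𝓝 0) ∧
        Tendsto (fun n => pW (Hit n - H')) atTop (𝓝 0)) ∧
    (∀ (E₀ : V) (H₀ : W), ∃ (E : ℕ → V) (H : ℕ → W),
      (E 0 = E₀ ∧ H 0 = H₀ ∧ ∀ m < M, ES (E m) (H m) (E (m + 1)) (E (m + 1)) ∧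
        HS (E (m + 1)) (H m) (H (m + 1)) (H (m + 1))) ∧
      (∀ (E' : ℕ → V) (H' : ℕ → W),
        (E' 0 = E₀ ∧ H' 0 = H₀ ∧ ∀ m < M, ES (E' m) (H' m) (E' (m + 1)) (E' (m + 1)) ∧
          HS (E' (m + 1)) (H' m) (H' (m + 1)) (H' (m + 1))) →
        ∀ m ≤ M, E' m = E m ∧ H' m = H m) ∧
      ∀ δ > (0 : ℝ), ∃ n₀ : ℕ, ∀ ν : ℕ → ℕ, (∀ m < M, n₀ ≤ ν m) →
        ∀ (E' : ℕ → V) (H' : ℕ → W),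
          (E' 0 = E₀ ∧ H' 0 = H₀ ∧ ∀ m < M, ∃ (Eit : ℕ → V) (Hit : ℕ → W),
            (Eit 0 = E' m ∧ Hit 0 = H' m ∧ ∀ n, ES (E' m) (H' m) (Eit n) (Eit (n + 1)) ∧
              HS (E' (m + 1)) (H' m) (Hit n) (Hit (n + 1))) ∧
            E' (m + 1) = Eit (ν m) ∧ H' (m + 1) = Hit (ν m)) →
          ∀ m ≤ M, pV (E' m - E m) < δ ∧ pW (H' m - H m) < δ) := by
  obtain ⟨Φ, hΦ⟩ := exists_riesz a hpos
  obtain ⟨Φ', hΦ'⟩ := exists_riesz a' hpos'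
  -- The spaces carry no norm up to here. The energy norm is the one in which the implicit parts
  -- contract, with factors √ρ and √ρ'; the norms of the conclusion enter only through `pV` and
  -- `pW`.
  let : NormedAddCommGroup V := (energyCore a hsymm hpos).toNormedAddCommGroup
  let : InnerProductSpace ℝ V := .ofCore (energyCore a hsymm hpos).toCore
  let : NormedAddCommGroup W := (energyCore a' hsymm' hpos').toNormedAddCommGroup
  let : InnerProductSpace ℝ W := .ofCore (energyCore a' hsymm' hpos').toCore
  refine coupled_iteration_of_norm (R := Φ ∘ₗ d) (G := Φ ∘ₗ b) (R' := Φ' ∘ₗ d') (G' := Φ' ∘ₗ b')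
    (q := √ρ) (q' := √ρ')
    (fun E H P E' => ?_) (fun E H P E' => ?_) (Real.sqrt_nonneg _) ?_
    (contracting_riesz a b hρ0 hb hΦ) (Real.sqrt_nonneg _) ?_ (contracting_riesz a' b' hρ0' hb' hΦ')
    hC hpV0 hpV hpW0 hpW M
  · rw [hES]
    have := hΦ (d H + b (E + P)) (E' - E)
    simp only [LinearMap.add_apply] at this
    rw [this, sub_eq_iff_eq_add, map_add]
    simp only [LinearMap.comp_apply]
    rw [add_assoc, add_comm E]
    abel_nf
  · rw [hHS]
    have := hΦ' (d' E + b' (H + P)) (E' - H)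
    simp only [LinearMap.add_apply] at this
    rw [this, sub_eq_iff_eq_add, map_add]
    simp only [LinearMap.comp_apply]
    rw [add_assoc, add_comm H]
    abel_nf
  · rw [Real.sqrt_lt' one_pos]; linarith
  · rw [Real.sqrt_lt' one_pos]; linarith

end Energy

namespace TriMesh

/-! ### Geometry of the mesh -/

/-- Twice the signed area of the triangle `A`, `B`, `X`, up to a global sign. -/
def side (A B X : Plane) : ℝ := (B - A) 1 * (X - A) 0 - (B - A) 0 * (X - A) 1

lemma side_swap (A B X : Plane) : side B A X = -side A B X := by
  simp only [side, PiLp.sub_apply]; ring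

variable (T : TriMesh)

lemma range_points (k : Fin T.K) (e : Fin 3) :
    Set.range (T.tri k).points = {(T.tri k).points e, T.edgeA k e, T.edgeB k e} := by
  ext x
  simp only [Set.mem_range, Set.mem_insert_iff, Set.mem_singleton_iff, edgeA, edgeB]
  have h : ∀ e i : Fin 3, i = e ∨ i = e + 1 ∨ i = e + 2 := by decide
  constructor
  · rintro ⟨i, rfl⟩
    rcases h e i with rfl | rfl | rfl <;> simp
  · rintro (rfl | rfl | rfl) <;> exact ⟨_, rfl⟩

lemma points_injective (k : Fin T.K) : Function.Injective (T.tri k).points :=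
  (T.tri k).independent.injective

lemma edgeA_ne_edgeB (k : Fin T.K) (e : Fin 3) : T.edgeA k e ≠ T.edgeB k e := by
  intro h
  have h1 := T.points_injective k h
  have h2 : ∀ e : Fin 3, e + 1 ≠ e + 2 := by decide
  exact h2 e h1

lemma dist_edge_pos (k : Fin T.K) (e : Fin 3) : 0 < dist (T.edgeA k e) (T.edgeB k e) :=
  dist_pos.2 (T.edgeA_ne_edgeB k e)

/-- Points on the line through two points are characterised by vanishing of `side`. -/
lemma exists_smul_of_side_eq_zero {A B X : Plane} (hAB : A ≠ B) (h : side A B X = 0) :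
    ∃ r : ℝ, X - A = r • (B - A) := by
  have hne : (B - A) 0 ≠ 0 ∨ (B - A) 1 ≠ 0 := by
    by_contra! hc
    apply hAB
    symm
    rw [← sub_eq_zero]
    ext i
    fin_cases i
    · exact hc.1
    · exact hc.2
  unfold side at h
  rcases hne with hne | hne
  · refine ⟨(X - A) 0 / (B - A) 0, ?_⟩
    ext i
    fin_cases i
    · simp only [Fin.zero_eta, PiLp.smul_apply, smul_eq_mul]
      field_simp
    · simp only [Fin.mk_one, PiLp.smul_apply, smul_eq_mul]
      field_simp
      linarith
  · refine ⟨(X - A) 1 / (B - A) 1, ?_⟩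
    ext i
    fin_cases i
    · simp only [Fin.zero_eta, PiLp.smul_apply, smul_eq_mul]
      field_simp
      linarith
    · simp only [Fin.mk_one, PiLp.smul_apply, smul_eq_mul]
      field_simp

lemma side_ne_zero (k : Fin T.K) (e : Fin 3) :
    side (T.edgeA k e) (T.edgeB k e) ((T.tri k).points e) ≠ 0 := by
  intro h
  have hind := (T.tri k).independent
  rw [affineIndependent_iff_not_collinear, T.range_points k e] at hind
  apply hind
  obtain ⟨r, hr⟩ := exists_smul_of_side_eq_zero (T.edgeA_ne_edgeB k e) h
  rw [collinear_iff_of_mem (p₀ := T.edgeA k e) (by simp)]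
  refine ⟨T.edgeB k e - T.edgeA k e, ?_⟩
  rintro p (rfl | rfl | rfl)
  · exact ⟨r, by rw [← hr]; simp⟩
  · exact ⟨0, by simp⟩
  · exact ⟨1, by simp⟩

lemma inner_edgeRot (k : Fin T.K) (e : Fin 3) (X : Plane) :
    inner ℝ (T.edgeRot k e) (X - T.edgeA k e) = side (T.edgeA k e) (T.edgeB k e) X := by
  simp [edgeRot, side, PiLp.inner_apply, Fin.sum_univ_two]
  ring

/-- Products of two components do not see the sign of the normal. Impedances and squared tangential
traces depend on the normal only through such products, so the orientation of the normals on a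
shared edge never has to be compared. -/
lemma normal_mul_normal (k : Fin T.K) (e : Fin 3) (i l : Fin 2) :
    T.normal k e i * T.normal k e l =
      T.edgeRot k e i * T.edgeRot k e l / dist (T.edgeA k e) (T.edgeB k e) ^ 2 := by
  have hs : ((SignType.sign (inner ℝ (T.edgeRot k e)
      ((T.tri k).points e - T.edgeA k e)) : ℝ)) ^ 2 = 1 := by
    rw [inner_edgeRot]
    rcases lt_or_gt_of_ne (T.side_ne_zero k e) with h | h <;> simp [h]
  simp only [normal, PiLp.smul_apply, smul_eq_mul]
  have hd := (T.dist_edge_pos k e).ne'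
  field_simp
  linear_combination (T.edgeRot k e i * T.edgeRot k e l) * hs

lemma normal_sq_add_sq (k : Fin T.K) (e : Fin 3) :
    T.normal k e 0 ^ 2 + T.normal k e 1 ^ 2 = 1 := by
  have hd := (T.dist_edge_pos k e).ne'
  rw [sq, sq, normal_mul_normal, normal_mul_normal, ← add_div, div_eq_one_iff_eq (pow_ne_zero 2 hd),
    EuclideanSpace.dist_eq, Real.sq_sqrt (by positivity)]
  simp [edgeRot, Fin.sum_univ_two, Real.dist_eq]
  ring

/-- Edge `e` of triangle `k` and edge `f` of triangle `j` have the same end points. -/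
def SameEdge (k : Fin T.K) (e : Fin 3) (j : Fin T.K) (f : Fin 3) : Prop :=
  (T.edgeA j f = T.edgeA k e ∧ T.edgeB j f = T.edgeB k e) ∨
    (T.edgeA j f = T.edgeB k e ∧ T.edgeB j f = T.edgeA k e)

variable {T}

lemma SameEdge.symm {k j : Fin T.K} {e f : Fin 3} (h : T.SameEdge k e j f) :
    T.SameEdge j f k e := by
  rcases h with ⟨h1, h2⟩ | ⟨h1, h2⟩
  · exact Or.inl ⟨h1.symm, h2.symm⟩
  · exact Or.inr ⟨h2.symm, h1.symm⟩

lemma SameEdge.trans {k j i : Fin T.K} {e f g : Fin 3} (h : T.SameEdge k e j f)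
    (h' : T.SameEdge j f i g) : T.SameEdge k e i g := by
  unfold SameEdge at *
  rcases h with ⟨h1, h2⟩ | ⟨h1, h2⟩ <;> rw [h1, h2] at h' <;> tauto

lemma SameEdge.eq_of_same_cell {k : Fin T.K} {e f : Fin 3} (h : T.SameEdge k e k f) : e = f := by
  have hdec : ∀ e f : Fin 3, (f + 1 = e + 1 ∧ f + 2 = e + 2) ∨ (f + 1 = e + 2 ∧ f + 2 = e + 1) →
      e = f := by decide
  have hinj := T.points_injective k
  apply hdec
  rcases h with ⟨h1, h2⟩ | ⟨h1, h2⟩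
  · exact Or.inl ⟨hinj h1, hinj h2⟩
  · exact Or.inr ⟨hinj h1, hinj h2⟩

lemma exists_sameEdge_of_nbr {k j : Fin T.K} {e : Fin 3} (h : T.nbr k e = some j) :
    j ≠ k ∧ ∃ f, T.SameEdge k e j f := by
  unfold nbr at h
  split_ifs at h with hj
  have hn := hj.choose_spec
  rw [Option.some.inj h] at hn
  obtain ⟨hne, ⟨a, ha⟩, ⟨b, hb⟩⟩ := hn
  refine ⟨hne, ?_⟩
  have hab : a ≠ b := by
    rintro rfl
    exact T.edgeA_ne_edgeB k e (ha.symm.trans hb)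
  have hdec : ∀ a b : Fin 3, a ≠ b → ∃ f : Fin 3, (f + 1 = a ∧ f + 2 = b) ∨
      (f + 1 = b ∧ f + 2 = a) := by decide
  obtain ⟨f, ⟨rfl, rfl⟩ | ⟨rfl, rfl⟩⟩ := hdec a b hab
  · exact ⟨f, Or.inl ⟨ha, hb⟩⟩
  · exact ⟨f, Or.inr ⟨hb, ha⟩⟩

lemma SameEdge.dist_eq {k j : Fin T.K} {e f : Fin 3} (h : T.SameEdge k e j f) :
    dist (T.edgeA k e) (T.edgeB k e) = dist (T.edgeA j f) (T.edgeB j f) := by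
  rcases h with ⟨h1, h2⟩ | ⟨h1, h2⟩
  · rw [h1, h2]
  · rw [h1, h2, dist_comm]

lemma SameEdge.normal_mul_normal {k j : Fin T.K} {e f : Fin 3} (h : T.SameEdge k e j f)
    (i l : Fin 2) :
    T.normal k e i * T.normal k e l = T.normal j f i * T.normal j f l := by
  rw [TriMesh.normal_mul_normal, TriMesh.normal_mul_normal, h.dist_eq]
  congr 1
  rcases h with ⟨h1, h2⟩ | ⟨h1, h2⟩
  · simp only [edgeRot, h1, h2]
  · have : T.edgeRot k e = -T.edgeRot j f := by
      ext i
      fin_cases i <;> simp [edgeRot, h1, h2]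
    rw [this]
    simp

lemma SameEdge.edgeInt_eq {k j : Fin T.K} {e f : Fin 3} (h : T.SameEdge k e j f)
    (g : Plane → ℝ) : T.edgeInt k e g = T.edgeInt j f g := by
  unfold edgeInt
  rw [h.dist_eq]
  congr 1
  rcases h with ⟨h1, h2⟩ | ⟨h1, h2⟩
  · simp only [edgePt, h1, h2]
  · have : ∀ t : ℝ, T.edgePt k e t = T.edgePt j f (1 - t) := fun t => by
      simp only [edgePt, h1, h2]
      rw [AffineMap.lineMap_apply_one_sub]
    simp only [this]
    rw [intervalIntegral.integral_comp_sub_left (fun t => g (T.edgePt j f t))]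
    simp

lemma convexHull_three (A B C : Plane) {a b c : ℝ} (ha : 0 ≤ a) (hb : 0 ≤ b) (hc : 0 ≤ c)
    (h : a + b + c = 1) : a • A + b • B + c • C ∈ convexHull ℝ {C, A, B} := by
  have hA : A ∈ convexHull ℝ {C, A, B} := subset_convexHull _ _ (by simp)
  have hB : B ∈ convexHull ℝ {C, A, B} := subset_convexHull _ _ (by simp)
  have hC : C ∈ convexHull ℝ {C, A, B} := subset_convexHull _ _ (by simp)
  exact (convex_convexHull ℝ _).sum_mem (t := (Finset.univ : Finset (Fin 3)))
    (w := ![a, b, c]) (z := ![A, B, C])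
    (by intro i _; fin_cases i <;> simpa) (by simp [Fin.sum_univ_three, h])
    (by intro i _; fin_cases i <;> simpa) |> (by simpa [Fin.sum_univ_three] using ·)

/-- Two triangles with a common edge lie on opposite sides of it. -/
lemma SameEdge.side_mul_side_neg {k j : Fin T.K} {e f : Fin 3} (h : T.SameEdge k e j f)
    (hkj : k ≠ j) :
    side (T.edgeA k e) (T.edgeB k e) ((T.tri k).points e) *
      side (T.edgeA k e) (T.edgeB k e) ((T.tri j).points f) < 0 := by
  have hk := T.side_ne_zero k e
  have hj : side (T.edgeA k e) (T.edgeB k e) ((T.tri j).points f) ≠ 0 := by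
    have := T.side_ne_zero j f
    rcases h with ⟨h1, h2⟩ | ⟨h1, h2⟩
    · rwa [h1, h2] at this
    · rw [h1, h2, side_swap] at this
      exact fun h0 => this (by rw [h0, neg_zero])
  have hrk := T.range_points k e
  have hrj : Set.range (T.tri j).points =
      {(T.tri j).points f, T.edgeA k e, T.edgeB k e} := by
    rw [T.range_points j f]
    rcases h with ⟨h1, h2⟩ | ⟨h1, h2⟩
    · rw [h1, h2]
    · rw [h1, h2, Set.pair_comm]
  have hAB := T.edgeA_ne_edgeB k e
  have hconf := T.conforming k j hkj
  have hvert := T.vertices_ne k j hkj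
  rw [hrk, hrj] at hconf hvert
  generalize T.edgeA k e = A at *
  generalize T.edgeB k e = B at *
  generalize (T.tri k).points e = C at *
  generalize (T.tri j).points f = D at *
  -- If the two opposite vertices C and D were on the same side of AB, a point near the midpoint of
  -- AB, pushed slightly towards C, would lie in both triangles but off the edge, against
  -- conformity.
  by_contra hcon
  have hpos : 0 < side A B C / side A B D := by
    rcases lt_or_gt_of_ne hk with h1 | h1 <;> rcases lt_or_gt_of_ne hj with h2 | h2
    · exact div_pos_of_neg_of_neg h1 h2
    · exact absurd (mul_neg_of_neg_of_pos h1 h2) hcon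
    · exact absurd (mul_neg_of_pos_of_neg h1 h2) hcon
    · exact div_pos h1 h2
  have hside0 : side A B A = 0 := by simp [side]
  have hside1 : side A B B = 0 := by simp [side]; ring
  have hCD : C ≠ D := fun hCD => hvert (by rw [hCD])
  have hinter : ({C, A, B} : Set Plane) ∩ {D, A, B} ⊆ {A, B} := by
    rintro x ⟨rfl | rfl | rfl, hx⟩
    · rcases hx with rfl | rfl | rfl
      · exact absurd rfl hCD
      · exact absurd hside0 hk
      · exact absurd hside1 hk
    · simp
    · simp
  -- The barycentric coordinate of C at D with respect to A, B, D is a quotient of signed areas,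
  -- positive by the assumption of equal sides.
  set c := side A B C / side A B D with hc
  obtain ⟨b, hb⟩ := exists_smul_of_side_eq_zero (X := C - c • (D - A)) hAB (by
    have : side A B (C - c • (D - A)) = side A B C - c * side A B D := by
      simp only [side, PiLp.sub_apply, PiLp.smul_apply, smul_eq_mul]; ring
    rw [this, hc, div_mul_cancel₀ _ hj, sub_self])
  have hC : C = (1 - b - c) • A + b • B + c • D := by
    have : C = A + b • (B - A) + c • (D - A) := by rw [← hb]; abel
    rw [this]
    module
  -- With this δ one has (1 - δ)/2 ≥ δ|b| and (1 - δ)/2 ≥ δ|1 - b - c|, so the coordinates of X at A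
  -- and B stay nonnegative when C is expanded in A, B, D.
  set δ : ℝ := 1 / (2 + 2 * |b| + 2 * |1 - b - c|) with hδ
  have hden : 0 < 2 + 2 * |b| + 2 * |1 - b - c| := by positivity
  have hδ0 : 0 < δ := by positivity
  have hδ1 : δ * (2 + 2 * |b| + 2 * |1 - b - c|) = 1 := by rw [hδ]; field_simp
  have hδb : 0 ≤ δ * |b| := by positivity
  have hδa : 0 ≤ δ * |1 - b - c| := by positivity
  have hb1 : -(δ * |b|) ≤ δ * b := by nlinarith [neg_abs_le b]
  have hb2 : -(δ * |1 - b - c|) ≤ δ * (1 - b - c) := by nlinarith [neg_abs_le (1 - b - c)]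
  set X := ((1 - δ) / 2) • A + ((1 - δ) / 2) • B + δ • C with hX
  have hX1 : X ∈ convexHull ℝ {C, A, B} :=
    convexHull_three A B C (by linarith) (by linarith) hδ0.le (by ring)
  have hX2 : X ∈ convexHull ℝ {D, A, B} := by
    have : X = ((1 - δ) / 2 + δ * (1 - b - c)) • A + ((1 - δ) / 2 + δ * b) • B + (δ * c) • D := by
      rw [hX]
      nth_rewrite 1 [hC]
      module
    rw [this]
    exact convexHull_three A B D (by linarith) (by linarith) (by positivity) (by ring)
  have hX3 : X ∈ segment ℝ A B := by
    rw [← convexHull_pair]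
    have : X ∈ convexHull ℝ {C, A, B} ∩ convexHull ℝ {D, A, B} := ⟨hX1, hX2⟩
    rw [hconf] at this
    exact convexHull_mono hinter this
  obtain ⟨u, v, -, -, huv, hXe⟩ := hX3
  have hs1 : side A B X = δ * side A B C := by
    rw [hX]
    simp only [side, PiLp.sub_apply, PiLp.smul_apply, PiLp.add_apply, smul_eq_mul]; ring
  have hs2 : side A B X = 0 := by
    rw [← hXe]
    have hu : u = 1 - v := by linarith
    simp only [side, PiLp.sub_apply, PiLp.smul_apply, PiLp.add_apply, smul_eq_mul, hu]; ring
  rw [hs2] at hs1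
  exact mul_ne_zero hδ0.ne' hk hs1.symm

/-- An edge of a triangle belongs to at most one other triangle. -/
lemma SameEdge.unique {k k' j : Fin T.K} {e e' f : Fin 3} (h : T.SameEdge k e j f)
    (h' : T.SameEdge k' e' j f) (hk : k ≠ j) (hk' : k' ≠ j) : k = k' ∧ e = e' := by
  have hkk : k = k' := by
    by_contra hne
    -- Three different triangles at one edge would lie pairwise on opposite sides. The product of
    -- the three pairwise products of signed areas is a square, yet it would be negative.
    have h1 := h.side_mul_side_neg hk
    have h2 := (h.trans h'.symm).side_mul_side_neg hne
    have h3 := h'.side_mul_side_neg hk'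
    have h4 : side (T.edgeA k' e') (T.edgeB k' e') ((T.tri k').points e') *
        side (T.edgeA k' e') (T.edgeB k' e') ((T.tri j).points f) =
        side (T.edgeA k e) (T.edgeB k e) ((T.tri k').points e') *
        side (T.edgeA k e) (T.edgeB k e) ((T.tri j).points f) := by
      rcases h.trans h'.symm with ⟨g1, g2⟩ | ⟨g1, g2⟩
      · rw [g1, g2]
      · rw [g1, g2, side_swap, side_swap (T.edgeA k e)]
        ring
    rw [h4] at h3
    have h5 := mul_pos_of_neg_of_neg h1 h2
    have h6 := mul_neg_of_pos_of_neg h5 h3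
    nlinarith [sq_nonneg (side (T.edgeA k e) (T.edgeB k e) ((T.tri k).points e) *
      side (T.edgeA k e) (T.edgeB k e) ((T.tri j).points f) *
      side (T.edgeA k e) (T.edgeB k e) ((T.tri k').points e'))]
  subst hkk
  exact ⟨rfl, (h.trans h'.symm).eq_of_same_cell⟩

variable (T)

lemma isCompact_cell (k : Fin T.K) : IsCompact (T.cell k) :=
  (Set.finite_range _).isCompact_convexHull (𝕜 := ℝ)

lemma measurableSet_cell (k : Fin T.K) : MeasurableSet (T.cell k) :=
  (T.isCompact_cell k).isClosed.measurableSet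

lemma volume_cell_ne_top (k : Fin T.K) : volume (T.cell k) ≠ ⊤ :=
  (T.isCompact_cell k).measure_lt_top.ne

lemma interior_cell_nonempty (k : Fin T.K) : (interior (T.cell k)).Nonempty := by
  unfold cell
  rw [interior_convexHull_nonempty_iff_affineSpan_eq_top,
    (T.tri k).independent.affineSpan_eq_top_iff_card_eq_finrank_add_one]
  simp

lemma edgePt_mem_cell (k : Fin T.K) (e : Fin 3) {t : ℝ} (ht : t ∈ Set.Icc (0 : ℝ) 1) :
    T.edgePt k e t ∈ T.cell k :=
  (convex_convexHull ℝ _).segment_subset (subset_convexHull ℝ _ (Set.mem_range_self (e + 1)))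
    (subset_convexHull ℝ _ (Set.mem_range_self (e + 2)))
    (by rw [segment_eq_image_lineMap]; exact ⟨t, ht, rfl⟩)

lemma continuous_edgePt (k : Fin T.K) (e : Fin 3) : Continuous (T.edgePt k e) :=
  AffineMap.lineMap_continuous

end TriMesh

/-! ### Pointwise estimates for the coefficients -/

section Pointwise

variable {εlo εhi μlo μhi : ℝ} {A : Matrix (Fin 2) (Fin 2) ℝ} {m : ℝ} {n : Plane}

lemma AdmissibleAt.quad_bounds (h : AdmissibleAt εlo εhi μlo μhi A m) (a b : ℝ) :
    εlo * (a ^ 2 + b ^ 2) ≤ A 0 0 * a ^ 2 + 2 * A 0 1 * a * b + A 1 1 * b ^ 2 ∧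
      A 0 0 * a ^ 2 + 2 * A 0 1 * a * b + A 1 1 * b ^ 2 ≤ εhi * (a ^ 2 + b ^ 2) := by
  have hs : A 1 0 = A 0 1 := h.1.apply 0 1
  have := h.2.1 ![a, b]
  simp only [Fin.sum_univ_two, Matrix.cons_val_zero, Matrix.cons_val_one, hs] at this
  constructor <;> nlinarith [this.1, this.2]

lemma AdmissibleAt.abs_entry_le (h : AdmissibleAt εlo εhi μlo μhi A m) (hlo : 0 < εlo)
    (i j : Fin 2) : |A i j| ≤ εhi := by
  have hs : A 1 0 = A 0 1 := h.1.apply 0 1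
  have h1 := h.quad_bounds 1 0
  have h2 := h.quad_bounds 0 1
  have h3 := h.quad_bounds 1 1
  have h4 := h.quad_bounds 1 (-1)
  rw [abs_le]
  fin_cases i <;> fin_cases j <;> simp only [Fin.zero_eta, Fin.mk_one, hs] <;>
    constructor <;> linarith

/-- The effective permittivity as `det / N` with `N` the normal component of the permittivity. -/
lemma AdmissibleAt.effPermittivity_eq (h : AdmissibleAt εlo εhi μlo μhi A m) (n : Plane) :
    effPermittivity A n = (A 0 0 * A 1 1 - A 0 1 ^ 2) /
      (A 0 0 * n 0 ^ 2 + 2 * A 0 1 * n 0 * n 1 + A 1 1 * n 1 ^ 2) := by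
  have hs : A 1 0 = A 0 1 := h.1.apply 0 1
  simp only [effPermittivity, Matrix.det_fin_two, Fin.sum_univ_two, hs]
  congr 1 <;> ring

/-- The tangential component is controlled by the energy density with the effective
permittivity as constant. -/
lemma AdmissibleAt.effPermittivity_mul_sq_le (h : AdmissibleAt εlo εhi μlo μhi A m)
    (hlo : 0 < εlo) (hn : n 0 ^ 2 + n 1 ^ 2 = 1) (a b : ℝ) :
    effPermittivity A n * (n 0 * b - n 1 * a) ^ 2 ≤
      A 0 0 * a ^ 2 + 2 * A 0 1 * a * b + A 1 1 * b ^ 2 := by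
  have hN := (h.quad_bounds (n 0) (n 1)).1
  rw [hn, mul_one] at hN
  have hN0 : 0 < A 0 0 * n 0 ^ 2 + 2 * A 0 1 * n 0 * n 1 + A 1 1 * n 1 ^ 2 := hlo.trans_le hN
  rw [h.effPermittivity_eq, div_mul_eq_mul_div, div_le_iff₀ hN0]
  -- Lagrange's identity for the form A: with v = (a, b), the product (vᵀAv)(nᵀAn) exceeds det A ·
  -- (n × v)² by the square of vᵀAn.
  nlinarith [sq_nonneg (A 0 0 * a * n 0 + A 0 1 * (a * n 1 + b * n 0) + A 1 1 * b * n 1)]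

/-- With the unit tangent τ = (-n₁, n₀), the quotient det A / nᵀAn is a Schur complement: the
minimum of the quadratic form on the line τ + ℝn. The minimiser has squared length 1 + s² ≥ 1, which
gives the lower bound; comparison with τ itself gives the upper one. -/
lemma AdmissibleAt.effPermittivity_bounds (h : AdmissibleAt εlo εhi μlo μhi A m)
    (hlo : 0 < εlo) (hn : n 0 ^ 2 + n 1 ^ 2 = 1) :
    εlo ≤ effPermittivity A n ∧ effPermittivity A n ≤ εhi := by
  constructor
  · have hN := (h.quad_bounds (n 0) (n 1)).1
    rw [hn, mul_one] at hN
    rw [h.effPermittivity_eq]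
    set N := A 0 0 * n 0 ^ 2 + 2 * A 0 1 * n 0 * n 1 + A 1 1 * n 1 ^ 2 with hNdef
    have hN0 : 0 < N := hlo.trans_le hN
    -- The numerator is nᵀAτ, so that τ - s n is A-orthogonal to n.
    set s := (-A 0 0 * n 1 * n 0 + A 0 1 * (n 0 ^ 2 - n 1 ^ 2) + A 1 1 * n 0 * n 1) / N with hs
    have hsN : s * N = -A 0 0 * n 1 * n 0 + A 0 1 * (n 0 ^ 2 - n 1 ^ 2) + A 1 1 * n 0 * n 1 := by
      rw [hs]; field_simp
    have h1 := (h.quad_bounds (-n 1 - s * n 0) (n 0 - s * n 1)).1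
    have h2 : (-n 1 - s * n 0) ^ 2 + (n 0 - s * n 1) ^ 2 = 1 + s ^ 2 := by
      linear_combination (1 + s ^ 2) * hn
    rw [h2] at h1
    have h3 : A 0 0 * (-n 1 - s * n 0) ^ 2 + 2 * A 0 1 * (-n 1 - s * n 0) * (n 0 - s * n 1) +
        A 1 1 * (n 0 - s * n 1) ^ 2 =
        (A 0 0 * n 1 ^ 2 - 2 * A 0 1 * n 0 * n 1 + A 1 1 * n 0 ^ 2) - s * (s * N) := by
      have : A 0 0 * (-n 1 - s * n 0) ^ 2 + 2 * A 0 1 * (-n 1 - s * n 0) * (n 0 - s * n 1) +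
        A 1 1 * (n 0 - s * n 1) ^ 2 =
        (A 0 0 * n 1 ^ 2 - 2 * A 0 1 * n 0 * n 1 + A 1 1 * n 0 ^ 2) + s * (s * N)
          - 2 * s * (-A 0 0 * n 1 * n 0 + A 0 1 * (n 0 ^ 2 - n 1 ^ 2) + A 1 1 * n 0 * n 1) := by
        rw [hNdef]; ring
      rw [this, ← hsN]; ring
    rw [h3] at h1
    rw [le_div_iff₀ hN0]
    have h4 : (A 0 0 * n 1 ^ 2 - 2 * A 0 1 * n 0 * n 1 + A 1 1 * n 0 ^ 2) * N - (s * N) ^ 2 =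
        A 0 0 * A 1 1 - A 0 1 ^ 2 := by
      rw [hsN, hNdef]
      linear_combination (A 0 0 * A 1 1 - A 0 1 ^ 2) * (n 0 ^ 2 + n 1 ^ 2 + 1) * hn
    nlinarith [mul_le_mul_of_nonneg_right h1 hN0.le, mul_nonneg hlo.le hN0.le,
      mul_nonneg (mul_nonneg hlo.le hN0.le) (sq_nonneg s)]
  · have h1 := h.effPermittivity_mul_sq_le hlo hn (-n 1) (n 0)
    have h2 := (h.quad_bounds (-n 1) (n 0)).2
    have h3 : n 0 * n 0 - n 1 * -n 1 = 1 := by linarith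
    rw [h3] at h1
    rw [show (-n 1) ^ 2 + n 0 ^ 2 = 1 by linarith] at h2
    linarith

lemma AdmissibleAt.impedance_bounds (h : AdmissibleAt εlo εhi μlo μhi A m)
    (hlo : 0 < εlo) (hμ : 0 < μlo) (hn : n 0 ^ 2 + n 1 ^ 2 = 1) :
    μlo / √(μhi * εhi) ≤ impedance A m n ∧ impedance A m n ≤ μhi / √(μlo * εlo) := by
  obtain ⟨h1, h2⟩ := h.effPermittivity_bounds hlo hn
  obtain ⟨h3, h4⟩ := h.2.2
  have hm : 0 < m := hμ.trans_le h3
  have he : 0 < effPermittivity A n := hlo.trans_le h1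
  unfold impedance
  rw [mul_one_div]
  constructor
  · exact div_le_div₀ hm.le h3 (Real.sqrt_pos.2 (mul_pos hm he))
      (Real.sqrt_le_sqrt (mul_le_mul h4 h2 he.le (hm.le.trans h4)))
  · exact div_le_div₀ (hm.le.trans h4) h4 (Real.sqrt_pos.2 (mul_pos hμ hlo))
      (Real.sqrt_le_sqrt (mul_le_mul h3 h1 hlo.le hm.le))

lemma AdmissibleAt.impedance_pos (h : AdmissibleAt εlo εhi μlo μhi A m)
    (hlo : 0 < εlo) (hμ : 0 < μlo) (hn : n 0 ^ 2 + n 1 ^ 2 = 1) : 0 < impedance A m n := by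
  have he : 0 < effPermittivity A n := hlo.trans_le (h.effPermittivity_bounds hlo hn).1
  have hm : 0 < m := hμ.trans_le h.2.2.1
  unfold impedance
  positivity

lemma AdmissibleAt.min_le_sqrt (h : AdmissibleAt εlo εhi μlo μhi A m)
    (hlo : 0 < εlo) (hμ : 0 < μlo) (hn : n 0 ^ 2 + n 1 ^ 2 = 1) :
    min εlo μlo ≤ √(m * effPermittivity A n) := by
  apply Real.le_sqrt_of_sq_le
  rw [sq]
  have hmin : 0 < min εlo μlo := lt_min hlo hμ
  exact mul_le_mul ((min_le_right _ _).trans h.2.2.1)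
    ((min_le_left _ _).trans (h.effPermittivity_bounds hlo hn).1) hmin.le
    (hμ.le.trans h.2.2.1)

/-- Since 1/Z = ε_eff / √(μ ε_eff), the numerator is absorbed by the energy density and the root is
at least the smaller lower bound. No infimum of the impedance appears, which is what cellwise
constant coefficients gain. -/
lemma AdmissibleAt.sq_div_impedance_le (h : AdmissibleAt εlo εhi μlo μhi A m)
    (hlo : 0 < εlo) (hμ : 0 < μlo) (hn : n 0 ^ 2 + n 1 ^ 2 = 1) (a b : ℝ) :
    (impedance A m n)⁻¹ * (n 0 * b - n 1 * a) ^ 2 ≤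
      (min εlo μlo)⁻¹ * (A 0 0 * a ^ 2 + 2 * A 0 1 * a * b + A 1 1 * b ^ 2) := by
  have he : 0 < effPermittivity A n := hlo.trans_le (h.effPermittivity_bounds hlo hn).1
  have hm : 0 < m := hμ.trans_le h.2.2.1
  have hs : 0 < √(m * effPermittivity A n) := Real.sqrt_pos.2 (mul_pos hm he)
  have h1 := h.effPermittivity_mul_sq_le hlo hn a b
  have hi : (impedance A m n)⁻¹ = (√(m * effPermittivity A n))⁻¹ * effPermittivity A n := by
    unfold impedance
    rw [mul_one_div, inv_div, inv_mul_eq_div, div_eq_div_iff hm.ne' hs.ne',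
      Real.mul_self_sqrt (mul_pos hm he).le]
    ring
  rw [hi, mul_assoc]
  refine mul_le_mul ?_ h1 (by positivity) (inv_nonneg.2 (lt_min hlo hμ).le)
  exact inv_anti₀ (lt_min hlo hμ) (h.min_le_sqrt hlo hμ hn)

/-- The magnetic counterpart: Z = μ / √(μ ε_eff), and μ is the weight of the magnetic energy. -/
lemma AdmissibleAt.impedance_le (h : AdmissibleAt εlo εhi μlo μhi A m)
    (hlo : 0 < εlo) (hμ : 0 < μlo) (hn : n 0 ^ 2 + n 1 ^ 2 = 1) :
    impedance A m n ≤ (min εlo μlo)⁻¹ * m := by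
  have hm : 0 < m := hμ.trans_le h.2.2.1
  unfold impedance
  rw [mul_one_div, inv_mul_eq_div]
  exact div_le_div_of_nonneg_left hm.le (lt_min hlo hμ) (h.min_le_sqrt hlo hμ hn)

lemma impedance_congr (A : Matrix (Fin 2) (Fin 2) ℝ) (m : ℝ) {n n' : Plane}
    (h : ∀ i l, n i * n l = n' i * n' l) : impedance A m n = impedance A m n' := by
  unfold impedance effPermittivity
  have : ∑ i, ∑ j, n i * A i j * n j = ∑ i, ∑ j, n' i * A i j * n' j := by
    refine Finset.sum_congr rfl fun i _ => Finset.sum_congr rfl fun j _ => ?_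
    rw [mul_right_comm, h, mul_right_comm]
  rw [this]

end Pointwise

/-! ### Weighted integrals of products of polynomials -/

lemma val_add (p q : MvPolynomial (Fin 2) ℝ) (x : Plane) : val (p + q) x = val p x + val q x :=
  map_add _ _ _

lemma val_sub (p q : MvPolynomial (Fin 2) ℝ) (x : Plane) : val (p - q) x = val p x - val q x :=
  map_sub _ _ _

lemma val_smul (r : ℝ) (p : MvPolynomial (Fin 2) ℝ) (x : Plane) :
    val (r • p) x = r * val p x := by
  simp [val, MvPolynomial.smul_eval]

lemma val_zero (x : Plane) : val 0 x = 0 := map_zero _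

lemma continuous_val (p : MvPolynomial (Fin 2) ℝ) : Continuous (val p) :=
  (MvPolynomial.continuous_eval p).comp (by fun_prop)

namespace TriMesh

variable (T : TriMesh)

/-- Measurable functions that are bounded on edge `e` of triangle `k`. -/
def EdgeBdd (k : Fin T.K) (e : Fin 3) (g : Plane → ℝ) : Prop :=
  Measurable g ∧ ∃ C, ∀ t ∈ Set.Icc (0 : ℝ) 1, |g (T.edgePt k e t)| ≤ C

/-- Measurable functions that are essentially bounded on triangle `k`. -/
def CellBdd (k : Fin T.K) (g : Plane → ℝ) : Prop :=
  Measurable g ∧ ∃ C, ∀ᵐ x ∂(volume.restrict (T.cell k)), |g x| ≤ C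

variable {T} {k : Fin T.K} {e : Fin 3} {g g' : Plane → ℝ}

lemma EdgeBdd.mul (h : T.EdgeBdd k e g) (h' : T.EdgeBdd k e g') :
    T.EdgeBdd k e fun x => g x * g' x := by
  obtain ⟨hm, C, hC⟩ := h
  obtain ⟨hm', C', hC'⟩ := h'
  refine ⟨hm.mul hm', C * C', fun t ht => ?_⟩
  rw [abs_mul]
  exact mul_le_mul (hC t ht) (hC' t ht) (abs_nonneg _) ((abs_nonneg _).trans (hC t ht))

lemma EdgeBdd.add (h : T.EdgeBdd k e g) (h' : T.EdgeBdd k e g') :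
    T.EdgeBdd k e fun x => g x + g' x := by
  obtain ⟨hm, C, hC⟩ := h
  obtain ⟨hm', C', hC'⟩ := h'
  exact ⟨hm.add hm', C + C',
    fun t ht => (abs_add_le _ _).trans (add_le_add (hC t ht) (hC' t ht))⟩

lemma EdgeBdd.of_continuous (h : Continuous g) : T.EdgeBdd k e g := by
  refine ⟨h.measurable, ?_⟩
  obtain ⟨C, hC⟩ := isCompact_Icc.exists_bound_of_continuousOn
    (h.comp (T.continuous_edgePt k e)).continuousOn (s := Set.Icc (0 : ℝ) 1)
  exact ⟨C, hC⟩

lemma EdgeBdd.const_mul (r : ℝ) (h : T.EdgeBdd k e g) : T.EdgeBdd k e fun x => r * g x :=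
  (EdgeBdd.of_continuous continuous_const).mul h

lemma EdgeBdd.val (p : MvPolynomial (Fin 2) ℝ) : T.EdgeBdd k e (val p) :=
  .of_continuous (continuous_val p)

lemma EdgeBdd.intervalIntegrable (h : T.EdgeBdd k e g) :
    IntervalIntegrable (fun t => g (T.edgePt k e t)) volume 0 1 := by
  obtain ⟨hm, C, hC⟩ := h
  rw [intervalIntegrable_iff_integrableOn_Icc_of_le zero_le_one]
  refine Measure.integrableOn_of_bounded (M := C) (by simp)
    (hm.comp (T.continuous_edgePt k e).measurable).aestronglyMeasurable ?_
  filter_upwards [ae_restrict_mem measurableSet_Icc] with t ht using hC t ht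

lemma CellBdd.mul (h : T.CellBdd k g) (h' : T.CellBdd k g') :
    T.CellBdd k fun x => g x * g' x := by
  obtain ⟨hm, C, hC⟩ := h
  obtain ⟨hm', C', hC'⟩ := h'
  refine ⟨hm.mul hm', C * C', ?_⟩
  filter_upwards [hC, hC'] with x h1 h2
  rw [abs_mul]
  exact mul_le_mul h1 h2 (abs_nonneg _) ((abs_nonneg _).trans h1)

lemma CellBdd.of_continuous (h : Continuous g) : T.CellBdd k g := by
  refine ⟨h.measurable, ?_⟩
  obtain ⟨C, hC⟩ := (T.isCompact_cell k).exists_bound_of_continuousOn h.continuousOn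
  refine ⟨C, ?_⟩
  filter_upwards [ae_restrict_mem (T.measurableSet_cell k)] with x hx using hC x hx

lemma CellBdd.val (p : MvPolynomial (Fin 2) ℝ) : T.CellBdd k (val p) :=
  .of_continuous (continuous_val p)

lemma CellBdd.integrableOn (h : T.CellBdd k g) : IntegrableOn g (T.cell k) := by
  obtain ⟨hm, C, hC⟩ := h
  exact Measure.integrableOn_of_bounded (M := C) (T.volume_cell_ne_top k)
    hm.aestronglyMeasurable hC

lemma edgeInt_add (h : T.EdgeBdd k e g) (h' : T.EdgeBdd k e g') :
    T.edgeInt k e (fun x => g x + g' x) = T.edgeInt k e g + T.edgeInt k e g' := by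
  unfold edgeInt
  rw [intervalIntegral.integral_add h.intervalIntegrable h'.intervalIntegrable, mul_add]

lemma edgeInt_const_mul (r : ℝ) :
    T.edgeInt k e (fun x => r * g x) = r * T.edgeInt k e g := by
  unfold edgeInt
  rw [intervalIntegral.integral_const_mul]
  ring

lemma edgeInt_mono (h : T.EdgeBdd k e g) (h' : T.EdgeBdd k e g')
    (hle : ∀ t ∈ Set.Icc (0 : ℝ) 1, g (T.edgePt k e t) ≤ g' (T.edgePt k e t)) :
    T.edgeInt k e g ≤ T.edgeInt k e g' := by
  unfold edgeInt
  exact mul_le_mul_of_nonneg_left (intervalIntegral.integral_mono_on zero_le_one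
    h.intervalIntegrable h'.intervalIntegrable hle) dist_nonneg

lemma abs_edgeInt_le (h : T.EdgeBdd k e g) (h' : T.EdgeBdd k e g')
    (hle : ∀ t ∈ Set.Icc (0 : ℝ) 1, |g (T.edgePt k e t)| ≤ g' (T.edgePt k e t)) :
    |T.edgeInt k e g| ≤ T.edgeInt k e g' := by
  rw [abs_le, ← neg_one_mul, ← edgeInt_const_mul]
  refine ⟨edgeInt_mono (h'.const_mul _) h fun t ht => ?_,
    edgeInt_mono h h' fun t ht => (abs_le.1 (hle t ht)).2⟩
  rw [neg_one_mul]
  exact (abs_le.1 (hle t ht)).1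

lemma edgeInt_nonneg (hle : ∀ t ∈ Set.Icc (0 : ℝ) 1, 0 ≤ g (T.edgePt k e t)) :
    0 ≤ T.edgeInt k e g :=
  mul_nonneg dist_nonneg (intervalIntegral.integral_nonneg zero_le_one hle)

/-- The bilinear form `(p, q) ↦ (g p, q)_f` on polynomials, for an edge `f`. -/
def edgeForm (hg : T.EdgeBdd k e g) :
    MvPolynomial (Fin 2) ℝ →ₗ[ℝ] MvPolynomial (Fin 2) ℝ →ₗ[ℝ] ℝ :=
  LinearMap.mk₂ ℝ (fun p q => T.edgeInt k e fun x => g x * val p x * val q x)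
    (fun p p' q => by
      rw [← edgeInt_add ((hg.mul (.val p)).mul (.val q)) ((hg.mul (.val p')).mul (.val q))]
      congr 1; ext x; rw [val_add]; ring)
    (fun r p q => by
      rw [smul_eq_mul, ← edgeInt_const_mul]
      congr 1; ext x; rw [val_smul]; ring)
    (fun p q q' => by
      rw [← edgeInt_add ((hg.mul (.val p)).mul (.val q)) ((hg.mul (.val p)).mul (.val q'))]
      congr 1; ext x; rw [val_add]; ring)
    (fun r p q => by
      rw [smul_eq_mul, ← edgeInt_const_mul]
      congr 1; ext x; rw [val_smul]; ring)

lemma edgeForm_apply (hg : T.EdgeBdd k e g) (p q : MvPolynomial (Fin 2) ℝ) :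
    edgeForm hg p q = T.edgeInt k e fun x => g x * val p x * val q x := rfl

/-- The bilinear form `(p, q) ↦ (g p, q)` on polynomials, for a triangle. -/
def cellForm (hg : T.CellBdd k g) :
    MvPolynomial (Fin 2) ℝ →ₗ[ℝ] MvPolynomial (Fin 2) ℝ →ₗ[ℝ] ℝ :=
  LinearMap.mk₂ ℝ (fun p q => ∫ x in T.cell k, g x * val p x * val q x)
    (fun p p' q => by
      rw [← integral_add ((hg.mul (.val p)).mul (.val q)).integrableOn
        ((hg.mul (.val p')).mul (.val q)).integrableOn]
      congr 1; ext x; rw [val_add]; ring)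
    (fun r p q => by
      rw [smul_eq_mul, ← integral_const_mul]
      congr 1; ext x; rw [val_smul]; ring)
    (fun p q q' => by
      rw [← integral_add ((hg.mul (.val p)).mul (.val q)).integrableOn
        ((hg.mul (.val p)).mul (.val q')).integrableOn]
      congr 1; ext x; rw [val_add]; ring)
    (fun r p q => by
      rw [smul_eq_mul, ← integral_const_mul]
      congr 1; ext x; rw [val_smul]; ring)

lemma cellForm_apply (hg : T.CellBdd k g) (p q : MvPolynomial (Fin 2) ℝ) :
    cellForm hg p q = ∫ x in T.cell k, g x * val p x * val q x := rfl

end TriMesh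

/-! ### Integrability of the coefficients and of the flux weights -/

namespace Coefficients

open TriMesh

variable {T : TriMesh} (c : Coefficients T)

lemma measurable_impedance (j : Fin T.K) (n : Plane) :
    Measurable fun x => impedance (c.eps j x) (c.mu j x) n := by
  have h := c.eps_measurable j
  have hμ := c.mu_measurable j
  unfold impedance effPermittivity
  simp only [Matrix.det_fin_two, Fin.sum_univ_two]
  fun_prop

lemma measurable_Zin (k : Fin T.K) (e : Fin 3) : Measurable (c.Zin k e) :=
  c.measurable_impedance k _

lemma Zout_eq_of_some {k j : Fin T.K} {e f : Fin 3} (h : T.nbr k e = some j)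
    (hs : T.SameEdge k e j f) (x : Plane) : c.Zout k e x = c.Zin j f x := by
  simp only [Zout, h, Zin]
  exact impedance_congr _ _ hs.normal_mul_normal

lemma Zout_eq_of_none {k : Fin T.K} {e : Fin 3} (h : T.nbr k e = none) (x : Plane) :
    c.Zout k e x = c.Zin k e x := by
  simp only [Zout, h]

lemma measurable_Zout (k : Fin T.K) (e : Fin 3) : Measurable (c.Zout k e) := by
  rcases hn : T.nbr k e with _ | j
  · rw [show c.Zout k e = c.Zin k e from funext (c.Zout_eq_of_none hn)]
    exact c.measurable_Zin k e
  · obtain ⟨-, f, hf⟩ := exists_sameEdge_of_nbr hn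
    rw [show c.Zout k e = c.Zin j f from funext (c.Zout_eq_of_some hn hf)]
    exact c.measurable_Zin j f

lemma Zin_bounds (k : Fin T.K) (e : Fin 3) {t : ℝ} (ht : t ∈ Set.Icc (0 : ℝ) 1) :
    0 < c.Zin k e (T.edgePt k e t) ∧ c.μlo / √(c.μhi * c.εhi) ≤ c.Zin k e (T.edgePt k e t) ∧
      c.Zin k e (T.edgePt k e t) ≤ c.μhi / √(c.μlo * c.εlo) :=
  ⟨(c.admissible_edge k e t ht).impedance_pos c.εlo_pos c.μlo_pos (T.normal_sq_add_sq k e),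
    (c.admissible_edge k e t ht).impedance_bounds c.εlo_pos c.μlo_pos (T.normal_sq_add_sq k e)⟩

lemma coeff_bounds_pos : 0 < c.μlo / √(c.μhi * c.εhi) := by
  have h := c.admissible_edge ⟨0, T.K_pos⟩ 0 0 (by simp)
  have h1 := h.effPermittivity_bounds c.εlo_pos (T.normal_sq_add_sq ⟨0, T.K_pos⟩ 0)
  have h2 := h.2.2
  have := c.εlo_pos
  have := c.μlo_pos
  exact div_pos c.μlo_pos (Real.sqrt_pos.2 (mul_pos (by linarith) (by linarith)))

end Coefficients

lemma TriMesh.SameEdge.exists_edgePt_eq {T : TriMesh} {k j : Fin T.K} {e f : Fin 3}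
    (h : T.SameEdge k e j f) {t : ℝ} (ht : t ∈ Set.Icc (0 : ℝ) 1) :
    ∃ s ∈ Set.Icc (0 : ℝ) 1, T.edgePt k e t = T.edgePt j f s := by
  rcases h with ⟨h1, h2⟩ | ⟨h1, h2⟩
  · exact ⟨t, ht, by simp only [edgePt, h1, h2]⟩
  · refine ⟨1 - t, ⟨by linarith [ht.2], by linarith [ht.1]⟩, ?_⟩
    simp only [edgePt, h1, h2]
    rw [AffineMap.lineMap_apply_one_sub]

/-- A pair of weights on the edges (impedance or conductance, seen from both sides), uniformly
positive, whose outer values are the inner values of the neighbour. -/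
structure EdgeWeight (T : TriMesh) where
  inn : Fin T.K → Fin 3 → Plane → ℝ
  out : Fin T.K → Fin 3 → Plane → ℝ
  lo : ℝ
  lo_pos : 0 < lo
  le_inn : ∀ k e, ∀ t ∈ Set.Icc (0 : ℝ) 1, lo ≤ inn k e (T.edgePt k e t)
  inn_bdd : ∀ k e, T.EdgeBdd k e (inn k e)
  measurable_out : ∀ k e, Measurable (out k e)
  out_eq_of_some : ∀ {k j e f}, T.nbr k e = some j → T.SameEdge k e j f → ∀ x,
    out k e x = inn j f x
  out_eq_of_none : ∀ {k e}, T.nbr k e = none → ∀ x, out k e x = inn k e x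

namespace Coefficients

variable {T : TriMesh} (c : Coefficients T)

/-- The impedance as an edge weight. -/
def impedanceWeight : EdgeWeight T where
  inn := c.Zin
  out := c.Zout
  lo := c.μlo / √(c.μhi * c.εhi)
  lo_pos := c.coeff_bounds_pos
  le_inn k e t ht := (c.Zin_bounds k e ht).2.1
  inn_bdd k e := ⟨c.measurable_Zin k e, _, fun t ht => by
    rw [abs_of_pos (c.Zin_bounds k e ht).1]
    exact (c.Zin_bounds k e ht).2.2⟩
  measurable_out := c.measurable_Zout
  out_eq_of_some := c.Zout_eq_of_some
  out_eq_of_none := c.Zout_eq_of_none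

/-- The conductance as an edge weight. -/
def conductanceWeight : EdgeWeight T where
  inn := c.Yin
  out := c.Yout
  lo := (c.μhi / √(c.μlo * c.εlo))⁻¹
  lo_pos := by
    have h := c.Zin_bounds ⟨0, T.K_pos⟩ 0 (t := 0) (by simp)
    exact inv_pos.2 (h.1.trans_le h.2.2)
  le_inn k e t ht := inv_anti₀ (c.Zin_bounds k e ht).1 (c.Zin_bounds k e ht).2.2
  inn_bdd k e := ⟨(c.measurable_Zin k e).inv, (c.μlo / √(c.μhi * c.εhi))⁻¹, fun t ht => by
    have h := c.Zin_bounds k e ht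
    rw [Yin, abs_of_pos (inv_pos.2 h.1)]
    exact inv_anti₀ c.coeff_bounds_pos h.2.1⟩
  measurable_out k e := (c.measurable_Zout k e).inv
  out_eq_of_some h hs x := by rw [Yout, Yin, c.Zout_eq_of_some h hs]
  out_eq_of_none h x := by rw [Yout, Yin, c.Zout_eq_of_none h]

lemma cellBdd_eps (k : Fin T.K) (i j : Fin 2) : T.CellBdd k fun x => c.eps k x i j := by
  refine ⟨c.eps_measurable k i j, c.εhi, ?_⟩
  filter_upwards [c.admissible_cell k] with x hx using hx.abs_entry_le c.εlo_pos i j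

lemma cellBdd_mu (k : Fin T.K) : T.CellBdd k (c.mu k) := by
  refine ⟨c.mu_measurable k, c.μhi, ?_⟩
  filter_upwards [c.admissible_cell k] with x hx
  rw [abs_of_pos (c.μlo_pos.trans_le hx.2.2.1)]
  exact hx.2.2.2

end Coefficients

/-! ### The dissipative part of the numerical flux -/

namespace EdgeWeight

open TriMesh

variable {T : TriMesh} (ζ : EdgeWeight T) {k : Fin T.K} {e : Fin 3}

lemma inn_pos {t : ℝ} (ht : t ∈ Set.Icc (0 : ℝ) 1) : 0 < ζ.inn k e (T.edgePt k e t) :=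
  ζ.lo_pos.trans_le (ζ.le_inn k e t ht)

lemma out_pos {t : ℝ} (ht : t ∈ Set.Icc (0 : ℝ) 1) : 0 < ζ.out k e (T.edgePt k e t) := by
  rcases hn : T.nbr k e with _ | j
  · rw [ζ.out_eq_of_none hn]
    exact ζ.inn_pos ht
  · obtain ⟨-, f, hf⟩ := exists_sameEdge_of_nbr hn
    rw [ζ.out_eq_of_some hn hf]
    obtain ⟨s, hs, h⟩ := hf.exists_edgePt_eq ht
    rw [h]
    exact ζ.inn_pos hs

lemma le_out {t : ℝ} (ht : t ∈ Set.Icc (0 : ℝ) 1) : ζ.lo ≤ ζ.out k e (T.edgePt k e t) := by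
  rcases hn : T.nbr k e with _ | j
  · rw [ζ.out_eq_of_none hn]
    exact ζ.le_inn _ _ _ ht
  · obtain ⟨-, f, hf⟩ := exists_sameEdge_of_nbr hn
    rw [ζ.out_eq_of_some hn hf]
    obtain ⟨s, hs, h⟩ := hf.exists_edgePt_eq ht
    rw [h]
    exact ζ.le_inn _ _ _ hs

variable (k e)

lemma inn_inv_bdd : T.EdgeBdd k e fun x => (ζ.inn k e x)⁻¹ :=
  ⟨(ζ.inn_bdd k e).1.inv, ζ.lo⁻¹, fun t ht => by
    rw [abs_of_pos (inv_pos.2 (ζ.inn_pos ht))]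
    exact inv_anti₀ ζ.lo_pos (ζ.le_inn k e t ht)⟩

lemma out_inv_bdd : T.EdgeBdd k e fun x => (ζ.out k e x)⁻¹ :=
  ⟨(ζ.measurable_out k e).inv, ζ.lo⁻¹, fun t ht => by
    rw [abs_of_pos (inv_pos.2 (ζ.out_pos ht))]
    exact inv_anti₀ ζ.lo_pos (ζ.le_out ht)⟩

lemma sum_inv_bdd : T.EdgeBdd k e fun x => 1 / (ζ.out k e x + ζ.inn k e x) := by
  refine ⟨measurable_const.div ((ζ.measurable_out k e).add (ζ.inn_bdd k e).1),
    ζ.lo⁻¹, fun t ht => ?_⟩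
  have h1 := ζ.out_pos (k := k) (e := e) ht
  have h2 := ζ.inn_pos (k := k) (e := e) ht
  beta_reduce
  rw [one_div, abs_of_pos (inv_pos.2 (add_pos h1 h2))]
  exact inv_anti₀ ζ.lo_pos (by linarith [ζ.le_out (k := k) (e := e) ht])

lemma ratio_bdd : T.EdgeBdd k e fun x => 1 / (ζ.out k e x + ζ.inn k e x) * ζ.out k e x := by
  refine ⟨(ζ.sum_inv_bdd k e).1.mul (ζ.measurable_out k e), 1, fun t ht => ?_⟩
  have h1 := ζ.out_pos (k := k) (e := e) ht
  have h2 := ζ.inn_pos (k := k) (e := e) ht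
  beta_reduce
  rw [one_div_mul_eq_div, abs_of_pos (by positivity), div_le_one (by positivity)]
  linarith

variable {k e} (α : ℝ) {V : Type*} [AddCommGroup V] [Module ℝ V]
  (i o : Fin T.K → Fin 3 → V →ₗ[ℝ] MvPolynomial (Fin 2) ℝ)

/-- The bilinear form of the dissipative part of the flux, for inner and outer traces `i`, `o`. -/
def fluxForm : V →ₗ[ℝ] V →ₗ[ℝ] ℝ :=
  -∑ k, ∑ e, fluxParam α k e • (edgeForm (ζ.sum_inv_bdd k e)).compl₁₂ (i k e - o k e) (i k e)

/-- The weighted squared norm of the inner traces. -/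
def edgeEnergy (v : V) : ℝ :=
  ∑ k, ∑ e, T.edgeInt k e fun x => (ζ.inn k e x)⁻¹ * val (i k e v) x ^ 2

variable {i o}

lemma weighted_trace_bdd (v : V) :
    T.EdgeBdd k e fun x => (ζ.inn k e x)⁻¹ * val (i k e v) x ^ 2 := by
  have := (ζ.inn_inv_bdd k e).mul ((EdgeBdd.val (i k e v)).mul (.val (i k e v)))
  simpa only [← sq] using this

lemma weighted_outer_trace_bdd (v : V) :
    T.EdgeBdd k e fun x => (ζ.out k e x)⁻¹ * val (o k e v) x ^ 2 := by
  have := (ζ.out_inv_bdd k e).mul ((EdgeBdd.val (o k e v)).mul (.val (o k e v)))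
  simpa only [← sq] using this

lemma edgeInt_weighted_trace_nonneg (v : V) :
    0 ≤ T.edgeInt k e fun x => (ζ.inn k e x)⁻¹ * val (i k e v) x ^ 2 :=
  edgeInt_nonneg fun _ ht => mul_nonneg (inv_nonneg.2 (ζ.inn_pos ht).le) (sq_nonneg _)

lemma edgeInt_weighted_outer_trace_nonneg (v : V) :
    0 ≤ T.edgeInt k e fun x => (ζ.out k e x)⁻¹ * val (o k e v) x ^ 2 :=
  edgeInt_nonneg fun _ ht => mul_nonneg (inv_nonneg.2 (ζ.out_pos ht).le) (sq_nonneg _)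

/-- The outer traces are inner traces of neighbours, and every inner trace occurs at most once. -/
lemma sum_outer_trace_le
    (ho_some : ∀ {k j e f}, T.nbr k e = some j → T.SameEdge k e j f → ∀ v x,
      val (o k e v) x ^ 2 = val (i j f v) x ^ 2)
    (ho_none : ∀ {k e}, T.nbr k e = none → ∀ v, o k e v = 0) (v : V) :
    ∑ k, ∑ e, T.edgeInt k e (fun x => (ζ.out k e x)⁻¹ * val (o k e v) x ^ 2) ≤
      ζ.edgeEnergy i v := by
  classical
  unfold edgeEnergy
  rw [← Fintype.sum_prod_type' (f := fun k e => T.edgeInt k e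
      (fun x => (ζ.out k e x)⁻¹ * val (o k e v) x ^ 2)),
    ← Fintype.sum_prod_type' (f := fun k e => T.edgeInt k e
      (fun x => (ζ.inn k e x)⁻¹ * val (i k e v) x ^ 2))]
  -- An interior edge is sent to the same edge seen from the neighbour; an outer edge is sent to
  -- itself as a dummy value, and its outer trace is zero anyway.
  have hex : ∀ p : Fin T.K × Fin 3, ∃ p' : Fin T.K × Fin 3, (∃ j, T.nbr p.1 p.2 = some j) →
      T.nbr p.1 p.2 = some p'.1 ∧ T.SameEdge p.1 p.2 p'.1 p'.2 := by
    intro p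
    by_cases h : ∃ j, T.nbr p.1 p.2 = some j
    · obtain ⟨j, hj⟩ := h
      obtain ⟨-, f, hf⟩ := exists_sameEdge_of_nbr hj
      exact ⟨(j, f), fun _ => ⟨hj, hf⟩⟩
    · exact ⟨p, fun h' => absurd h' h⟩
  choose φ hφ using hex
  set S : Finset (Fin T.K × Fin 3) := Finset.univ.filter fun p => ∃ j, T.nbr p.1 p.2 = some j
    with hS
  -- Injectivity is where conformity enters: an edge of a triangle belongs to at most one other
  -- triangle.
  have hinj : Set.InjOn φ S := by
    intro p hp p' hp' h
    have hp1 := (Finset.mem_filter.1 hp).2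
    have hp2 := (Finset.mem_filter.1 hp').2
    obtain ⟨h1, h2⟩ := hφ p hp1
    obtain ⟨h3, h4⟩ := hφ p' hp2
    rw [← h] at h3 h4
    have := h2.unique h4 (exists_sameEdge_of_nbr h1).1.symm (exists_sameEdge_of_nbr h3).1.symm
    exact Prod.ext this.1 this.2
  calc _ = ∑ p ∈ S, T.edgeInt p.1 p.2
        (fun x => (ζ.out p.1 p.2 x)⁻¹ * val (o p.1 p.2 v) x ^ 2) := by
        symm
        apply Finset.sum_subset (Finset.subset_univ _)
        intro p _ hp
        have hnone : T.nbr p.1 p.2 = none := by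
          rw [Option.eq_none_iff_forall_ne_some]
          intro j hj
          exact hp (Finset.mem_filter.2 ⟨Finset.mem_univ _, j, hj⟩)
        simp [ho_none hnone, val_zero, edgeInt]
    _ = ∑ p ∈ S, T.edgeInt (φ p).1 (φ p).2
        (fun x => (ζ.inn (φ p).1 (φ p).2 x)⁻¹ * val (i (φ p).1 (φ p).2 v) x ^ 2) := by
        refine Finset.sum_congr rfl fun p hp => ?_
        obtain ⟨h1, h2⟩ := hφ p (Finset.mem_filter.1 hp).2
        rw [h2.edgeInt_eq]
        congr 1
        ext x
        rw [ζ.out_eq_of_some h1 h2, ho_some h1 h2]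
    _ = ∑ p ∈ S.image φ, T.edgeInt p.1 p.2
        (fun x => (ζ.inn p.1 p.2 x)⁻¹ * val (i p.1 p.2 v) x ^ 2) := by
        rw [Finset.sum_image hinj]
    _ ≤ _ := Finset.sum_le_sum_of_subset_of_nonneg (Finset.subset_univ _)
        fun p _ _ => ζ.edgeInt_weighted_trace_nonneg v

/-- After Young's inequality, (x - y)²/(z + z') ≤ x²/z + y²/z' separates the two traces, each with
the weight of its own side, without the factor two of the crude bound (x - y)² ≤ 2x² + 2y². -/
lemma abs_flux_density_le {z z' x y w : ℝ} (hz : 0 < z) (hz' : 0 < z') :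
    |1 / (z' + z) * (x - y) * w| ≤
      1 / 2 * (z⁻¹ * x ^ 2) + 1 / 2 * (z'⁻¹ * y ^ 2) + 1 / 2 * (z⁻¹ * w ^ 2) := by
  have h1 : |1 / (z' + z) * (x - y) * w| ≤
      1 / 2 * ((z' + z)⁻¹ * (x - y) ^ 2) + 1 / 2 * ((z' + z)⁻¹ * w ^ 2) := by
    rw [mul_assoc, abs_mul, abs_of_pos (by positivity : 0 < 1 / (z' + z)), one_div, abs_mul]
    have h0 : 0 < (z' + z)⁻¹ := by positivity
    have h2 := two_mul_le_add_sq |x - y| |w|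
    rw [sq_abs, sq_abs] at h2
    nlinarith
  have h2 : (z' + z)⁻¹ * (x - y) ^ 2 ≤ z⁻¹ * x ^ 2 + z'⁻¹ * y ^ 2 := by
    rw [inv_mul_eq_div, div_le_iff₀ (by positivity)]
    have : (z⁻¹ * x ^ 2 + z'⁻¹ * y ^ 2) * (z' + z) - (x - y) ^ 2 =
        (z' * x + z * y) ^ 2 / (z * z') := by
      field_simp
      ring
    have h3 : 0 ≤ (z' * x + z * y) ^ 2 / (z * z') := by positivity
    linarith
  have h3 : (z' + z)⁻¹ * w ^ 2 ≤ z⁻¹ * w ^ 2 :=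
    mul_le_mul_of_nonneg_right (inv_anti₀ hz (by linarith)) (sq_nonneg _)
  linarith

lemma abs_edgeForm_le (v w : V) :
    |edgeForm (ζ.sum_inv_bdd k e) (i k e v - o k e v) (i k e w)| ≤
      1 / 2 * T.edgeInt k e (fun x => (ζ.inn k e x)⁻¹ * val (i k e v) x ^ 2) +
      1 / 2 * T.edgeInt k e (fun x => (ζ.out k e x)⁻¹ * val (o k e v) x ^ 2) +
      1 / 2 * T.edgeInt k e (fun x => (ζ.inn k e x)⁻¹ * val (i k e w) x ^ 2) := by
  have b1 := (ζ.weighted_trace_bdd (k := k) (e := e) (i := i) v).const_mul (1 / 2)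
  have b2 := (ζ.weighted_outer_trace_bdd (k := k) (e := e) (o := o) v).const_mul (1 / 2)
  have b3 := (ζ.weighted_trace_bdd (k := k) (e := e) (i := i) w).const_mul (1 / 2)
  rw [← edgeInt_const_mul, ← edgeInt_const_mul, ← edgeInt_const_mul, ← edgeInt_add b1 b2,
    ← edgeInt_add (b1.add b2) b3, edgeForm_apply]
  refine abs_edgeInt_le (((ζ.sum_inv_bdd k e).mul (.val _)).mul (.val _)) ((b1.add b2).add b3)
    fun t ht => ?_
  rw [val_sub]
  exact abs_flux_density_le (ζ.inn_pos ht) (ζ.out_pos ht)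

/-- On the outer boundary both weights agree, which gains a factor of two. -/
lemma abs_edgeForm_le_of_nbr_eq_none (hn : T.nbr k e = none) (v w : V) :
    |edgeForm (ζ.sum_inv_bdd k e) (i k e v) (i k e w)| ≤
      1 / 4 * T.edgeInt k e (fun x => (ζ.inn k e x)⁻¹ * val (i k e v) x ^ 2) +
      1 / 4 * T.edgeInt k e (fun x => (ζ.inn k e x)⁻¹ * val (i k e w) x ^ 2) := by
  have b1 := (ζ.weighted_trace_bdd (k := k) (e := e) (i := i) v).const_mul (1 / 4)
  have b2 := (ζ.weighted_trace_bdd (k := k) (e := e) (i := i) w).const_mul (1 / 4)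
  rw [← edgeInt_const_mul, ← edgeInt_const_mul, ← edgeInt_add b1 b2, edgeForm_apply]
  refine abs_edgeInt_le (((ζ.sum_inv_bdd k e).mul (.val _)).mul (.val _)) (b1.add b2)
    fun t ht => ?_
  rw [ζ.out_eq_of_none hn]
  have hz := ζ.inn_pos (k := k) (e := e) ht
  generalize ζ.inn k e (T.edgePt k e t) = z at *
  generalize val (i k e v) (T.edgePt k e t) = x
  generalize val (i k e w) (T.edgePt k e t) = y
  rw [mul_assoc, abs_mul, abs_of_pos (by positivity : 0 < 1 / (z + z)), abs_mul,
    show 1 / (z + z) = 1 / 2 * z⁻¹ by field_simp; norm_num]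
  have h0 : 0 < z⁻¹ := by positivity
  have h2 := two_mul_le_add_sq |x| |y|
  rw [sq_abs, sq_abs] at h2
  nlinarith

/-- Bound of the dissipative flux form by the weighted norms of the traces. -/
lemma abs_fluxForm_le (hα : α = 0 ∨ α = 1)
    (ho_some : ∀ {k j e f}, T.nbr k e = some j → T.SameEdge k e j f → ∀ v x,
      val (o k e v) x ^ 2 = val (i j f v) x ^ 2)
    (ho_none : ∀ {k e}, T.nbr k e = none → ∀ v, o k e v = 0) (v w : V) :
    |ζ.fluxForm α i o v w| ≤
      (1 + 3 * α) / 4 * ζ.edgeEnergy i v + (1 + α) / 4 * ζ.edgeEnergy i w := by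
  have hα0 : 0 ≤ α := by rcases hα with rfl | rfl <;> norm_num
  -- The coefficients cover both values of α. For α = 0 only outer edges contribute, with 1/4 and
  -- 1/4; for α = 1 inner edges contribute 1/2 three times, which also dominates the outer edges.
  have hedge : ∀ k e,
      |fluxParam α k e * edgeForm (ζ.sum_inv_bdd k e) (i k e v - o k e v) (i k e w)| ≤
      (1 + α) / 4 * T.edgeInt k e (fun x => (ζ.inn k e x)⁻¹ * val (i k e v) x ^ 2) +
      α / 2 * T.edgeInt k e (fun x => (ζ.out k e x)⁻¹ * val (o k e v) x ^ 2) +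
      (1 + α) / 4 * T.edgeInt k e (fun x => (ζ.inn k e x)⁻¹ * val (i k e w) x ^ 2) := by
    intro k e
    have p1 := ζ.edgeInt_weighted_trace_nonneg (k := k) (e := e) (i := i) v
    have p2 := ζ.edgeInt_weighted_trace_nonneg (k := k) (e := e) (i := i) w
    have p3 := ζ.edgeInt_weighted_outer_trace_nonneg (k := k) (e := e) (o := o) v
    rcases hn : T.nbr k e with _ | j
    · have hfp : fluxParam α k e = 1 := by simp [fluxParam, hn]
      have ho := ho_none hn v
      have h := ζ.abs_edgeForm_le_of_nbr_eq_none (i := i) hn v w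
      rw [ho] at p3 ⊢
      rw [sub_zero]
      rw [hfp, one_mul]
      nlinarith [mul_nonneg hα0 p1, mul_nonneg hα0 p2, mul_nonneg hα0 p3]
    · have hfp : fluxParam α k e = α := by simp [fluxParam, hn]
      have h := ζ.abs_edgeForm_le (k := k) (e := e) (i := i) (o := o) v w
      rw [hfp, abs_mul, abs_of_nonneg hα0]
      rcases hα with rfl | rfl
      · nlinarith
      · linarith
  have hsum := ζ.sum_outer_trace_le (i := i) (o := o) ho_some ho_none v
  have hform : ζ.fluxForm α i o v w = -∑ k, ∑ e, fluxParam α k e *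
      edgeForm (ζ.sum_inv_bdd k e) (i k e v - o k e v) (i k e w) := by
    simp [fluxForm, LinearMap.sum_apply, LinearMap.compl₁₂_apply]
  rw [hform, abs_neg]
  calc _ ≤ ∑ k, ∑ e, |fluxParam α k e *
        edgeForm (ζ.sum_inv_bdd k e) (i k e v - o k e v) (i k e w)| :=
        (Finset.abs_sum_le_sum_abs _ _).trans
          (Finset.sum_le_sum fun k _ => Finset.abs_sum_le_sum_abs _ _)
    _ ≤ _ := Finset.sum_le_sum fun k _ => Finset.sum_le_sum fun e _ => hedge k e
    _ = (1 + α) / 4 * ζ.edgeEnergy i v + α / 2 * (∑ k, ∑ e, T.edgeInt k e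
          (fun x => (ζ.out k e x)⁻¹ * val (o k e v) x ^ 2)) +
          (1 + α) / 4 * ζ.edgeEnergy i w := by
        simp only [edgeEnergy, Finset.mul_sum, Finset.sum_add_distrib]
    _ ≤ _ := by nlinarith

/-- If the traces are controlled by the energy with a small constant, then the dissipative flux
form generates a contraction in the energy norm. -/
lemma exists_contraction (hα : α = 0 ∨ α = 1)
    (ho_some : ∀ {k j e f}, T.nbr k e = some j → T.SameEdge k e j f → ∀ v x,
      val (o k e v) x ^ 2 = val (i j f v) x ^ 2)
    (ho_none : ∀ {k e}, T.nbr k e = none → ∀ v, o k e v = 0)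
    {a : V →ₗ[ℝ] V →ₗ[ℝ] ℝ} {Δt r : ℝ} (hΔt : 0 < Δt) (hr0 : 0 ≤ r) (hr : r < 4 / (1 + 2 * α))
    (henergy : ∀ v, Δt * ζ.edgeEnergy i v ≤ r * a v v) :
    ∃ ρ, 0 ≤ ρ ∧ ρ < 1 ∧
      ∀ x y, a y y = ((Δt / 2) • ζ.fluxForm α i o) x y → a y y ≤ ρ * a x x := by
  have hα0 : 0 ≤ α := by rcases hα with rfl | rfl <;> norm_num
  have hr' : r * (1 + 2 * α) < 4 := (lt_div_iff₀ (by positivity)).1 hr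
  have hden : 0 < 1 - r * (1 + α) / 8 := by
    nlinarith [mul_nonneg hr0 hα0]
  -- The part of the flux bound in y is absorbed on the left, which produces the denominator. The
  -- quotient is below 1 exactly when r (2 + 4α) < 8.
  refine ⟨r * (1 + 3 * α) / 8 / (1 - r * (1 + α) / 8), by positivity, ?_, fun x y hxy => ?_⟩
  · rw [div_lt_one hden]
    nlinarith
  · rw [div_mul_eq_mul_div, le_div_iff₀ hden]
    have h := (le_abs_self _).trans (ζ.abs_fluxForm_le α hα ho_some ho_none x y)
    have hx := henergy x
    have hy := henergy y
    simp only [LinearMap.smul_apply, smul_eq_mul] at hxy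
    have h1 := mul_le_mul_of_nonneg_left h (by positivity : 0 ≤ Δt / 2)
    rw [← hxy] at h1
    have h2 := mul_le_mul_of_nonneg_left hx (by positivity : 0 ≤ (1 + 3 * α) / 8)
    have h3 := mul_le_mul_of_nonneg_left hy (by positivity : 0 ≤ (1 + α) / 8)
    linarith

end EdgeWeight

/-! ### Variational form of the updates -/

namespace TriMesh

variable (T : TriMesh) {N : ℕ}

/-- The polynomial of a piecewise polynomial function on triangle `k`. -/
def cellPoly (k : Fin T.K) : T.HField N →ₗ[ℝ] MvPolynomial (Fin 2) ℝ :=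
  Submodule.subtype _ ∘ₗ LinearMap.proj k

/-- The polynomial of the neighbour across an edge, zero on the outer boundary. -/
def nbrPoly (k : Fin T.K) (e : Fin 3) : T.HField N →ₗ[ℝ] MvPolynomial (Fin 2) ℝ :=
  match T.nbr k e with
  | some j => T.cellPoly j
  | none => 0

/-- The tangential component with respect to an edge of a vector of two polynomials. -/
def tangential (k : Fin T.K) (e : Fin 3) (p : T.HField N →ₗ[ℝ] MvPolynomial (Fin 2) ℝ) :
    T.EField N →ₗ[ℝ] MvPolynomial (Fin 2) ℝ :=
  T.normal k e 0 • (p ∘ₗ LinearMap.snd ℝ _ _) - T.normal k e 1 • (p ∘ₗ LinearMap.fst ℝ _ _)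

/-- The tangential trace from inside. -/
def tangIn (k : Fin T.K) (e : Fin 3) : T.EField N →ₗ[ℝ] MvPolynomial (Fin 2) ℝ :=
  T.tangential k e (T.cellPoly k)

/-- The tangential trace from outside. -/
def tangOut (k : Fin T.K) (e : Fin 3) : T.EField N →ₗ[ℝ] MvPolynomial (Fin 2) ℝ :=
  T.tangential k e (T.nbrPoly k e)

variable {T} {k j : Fin T.K} {e f : Fin 3}

lemma cellPoly_apply (v : T.HField N) : T.cellPoly k v = (v k : MvPolynomial (Fin 2) ℝ) := rfl

lemma tangential_apply (p : T.HField N →ₗ[ℝ] MvPolynomial (Fin 2) ℝ) (E : T.EField N) :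
    T.tangential k e p E = T.normal k e 0 • p E.2 - T.normal k e 1 • p E.1 := rfl

lemma jump_eq (v : T.HField N) (x : Plane) :
    jump v k e x = val (T.cellPoly k v - T.nbrPoly k e v) x := by
  rw [val_sub]
  rcases hn : T.nbr k e with _ | j <;> simp [jump, nbrPoly, hn, cellPoly_apply, val_zero]

lemma tjump_eq (E : T.EField N) (x : Plane) :
    tjump E k e x = val (T.tangIn k e E - T.tangOut k e E) x := by
  simp only [tjump, jump_eq, tangIn, tangOut, tangential_apply, val_sub, val_smul]
  ring

lemma nbrPoly_of_some (h : T.nbr k e = some j) (v : T.HField N) :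
    T.nbrPoly k e v = T.cellPoly j v := by
  simp [nbrPoly, h]

lemma nbrPoly_of_none (h : T.nbr k e = none) (v : T.HField N) : T.nbrPoly k e v = 0 := by
  simp [nbrPoly, h]

lemma tangOut_of_none (h : T.nbr k e = none) (E : T.EField N) : T.tangOut k e E = 0 := by
  simp [tangOut, tangential_apply, nbrPoly_of_none h]

/-- Both sides are traces of the field of the neighbour `j`, taken with the normals of the two
cells. Squaring leaves only products of normal components, which agree. -/
lemma val_tangOut_sq (h : T.nbr k e = some j) (hs : T.SameEdge k e j f) (E : T.EField N)
    (x : Plane) : val (T.tangOut k e E) x ^ 2 = val (T.tangIn j f E) x ^ 2 := by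
  simp only [tangOut, tangIn, tangential_apply, nbrPoly_of_some h, val_sub, val_smul]
  have h00 := hs.normal_mul_normal 0 0
  have h01 := hs.normal_mul_normal 0 1
  have h11 := hs.normal_mul_normal 1 1
  linear_combination (val (T.cellPoly j E.2) x) ^ 2 * h00 -
    2 * val (T.cellPoly j E.2) x * val (T.cellPoly j E.1) x * h01 +
    (val (T.cellPoly j E.1) x) ^ 2 * h11

lemma CellBdd.one (k : Fin T.K) : T.CellBdd k fun _ => (1 : ℝ) := .of_continuous continuous_const

/-- Testing a family of linear equations on the triangles one by one or all at once. -/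
lemma forall_cell_iff (F G : Fin T.K → Poly N →ₗ[ℝ] ℝ) :
    (∀ k u, F k u = G k u) ↔ ∀ w : T.HField N, ∑ k, F k (w k) = ∑ k, G k (w k) := by
  constructor
  · exact fun h w => Finset.sum_congr rfl fun k _ => h k _
  · intro h k u
    have hs : ∀ F : Fin T.K → Poly N →ₗ[ℝ] ℝ,
        ∑ k', F k' ((Pi.single k u : T.HField N) k') = F k u := by
      intro F
      rw [Finset.sum_eq_single k]
      · rw [Pi.single_eq_same]
      · intro b _ hb
        rw [Pi.single_eq_of_ne hb, map_zero]
      · simp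
    have := h (Pi.single k u)
    rwa [hs, hs] at this

lemma forall_cell_pair_iff (F F' G G' : Fin T.K → Poly N →ₗ[ℝ] ℝ) :
    ((∀ k u, F k u = G k u) ∧ (∀ k u, F' k u = G' k u)) ↔
      ∀ w : T.EField N, ∑ k, (F k (w.1 k) + F' k (w.2 k)) = ∑ k, (G k (w.1 k) + G' k (w.2 k)) := by
  rw [forall_cell_iff, forall_cell_iff]
  simp only [Finset.sum_add_distrib]
  constructor
  · exact fun h w => by rw [h.1, h.2]
  · exact fun h => ⟨fun w => by simpa using h (w, 0), fun w => by simpa using h (0, w)⟩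

/-- The partial derivative in direction `i` as a linear map. -/
def dPoly (i : Fin 2) : MvPolynomial (Fin 2) ℝ →ₗ[ℝ] MvPolynomial (Fin 2) ℝ :=
  (MvPolynomial.pderiv i : Derivation ℝ (MvPolynomial (Fin 2) ℝ) (MvPolynomial (Fin 2) ℝ))

lemma dPoly_apply (i : Fin 2) (p : MvPolynomial (Fin 2) ℝ) :
    dPoly i p = MvPolynomial.pderiv i p := rfl

end TriMesh

open TriMesh

/-- Separates the flux of the other, known field, which belongs to the data of the inner iteration,
from the penalty term, which generates the contraction. -/
lemma EdgeWeight.edgeInt_flux {T : TriMesh} (ζ : EdgeWeight T) (k : Fin T.K) (e : Fin 3)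
    (s r : ℝ) (p q u : MvPolynomial (Fin 2) ℝ) :
    T.edgeInt k e (fun x => s * (1 / (ζ.out k e x + ζ.inn k e x) *
        (ζ.out k e x * val p x - r * val q x)) * val u x) =
      s * (edgeForm (ζ.ratio_bdd k e) p u - r * edgeForm (ζ.sum_inv_bdd k e) q u) := by
  have h1 := ((ζ.ratio_bdd k e).mul (.val p)).mul (.val u)
  have h2 := (((ζ.sum_inv_bdd k e).mul (.val q)).mul (.val u)).const_mul (-r)
  rw [sub_eq_add_neg, ← neg_mul, edgeForm_apply, edgeForm_apply, ← edgeInt_const_mul (-r),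
    ← edgeInt_add h1 h2, ← edgeInt_const_mul]
  congr 1
  ext x
  ring

namespace Coefficients

variable {T : TriMesh} (c : Coefficients T) (N : ℕ)

/-- The mass form of the electric field. -/
def massE : T.EField N →ₗ[ℝ] T.EField N →ₗ[ℝ] ℝ :=
  ∑ k,
    ((cellForm (c.cellBdd_eps k 0 0)).compl₁₂ (T.cellPoly k ∘ₗ LinearMap.fst ℝ _ _)
        (T.cellPoly k ∘ₗ LinearMap.fst ℝ _ _) +
      (cellForm (c.cellBdd_eps k 0 1)).compl₁₂ (T.cellPoly k ∘ₗ LinearMap.snd ℝ _ _)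
        (T.cellPoly k ∘ₗ LinearMap.fst ℝ _ _) +
      (cellForm (c.cellBdd_eps k 1 0)).compl₁₂ (T.cellPoly k ∘ₗ LinearMap.fst ℝ _ _)
        (T.cellPoly k ∘ₗ LinearMap.snd ℝ _ _) +
      (cellForm (c.cellBdd_eps k 1 1)).compl₁₂ (T.cellPoly k ∘ₗ LinearMap.snd ℝ _ _)
        (T.cellPoly k ∘ₗ LinearMap.snd ℝ _ _))

/-- The mass form of the magnetic field. -/
def massH : T.HField N →ₗ[ℝ] T.HField N →ₗ[ℝ] ℝ :=
  ∑ k, (cellForm (c.cellBdd_mu k)).compl₁₂ (T.cellPoly k) (T.cellPoly k)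

/-- The action of the magnetic field on the electric equations. -/
def curlE : T.HField N →ₗ[ℝ] T.EField N →ₗ[ℝ] ℝ :=
  ∑ k, ((cellForm (CellBdd.one k)).compl₁₂ (dPoly 1 ∘ₗ T.cellPoly k)
        (T.cellPoly k ∘ₗ LinearMap.fst ℝ _ _) -
      (cellForm (CellBdd.one k)).compl₁₂ (dPoly 0 ∘ₗ T.cellPoly k)
        (T.cellPoly k ∘ₗ LinearMap.snd ℝ _ _) +
      ∑ e, (edgeForm (c.impedanceWeight.ratio_bdd k e)).compl₁₂
        (T.cellPoly k - T.nbrPoly k e) (T.tangIn k e))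

/-- The action of the electric field on the magnetic equation. -/
def curlH : T.EField N →ₗ[ℝ] T.HField N →ₗ[ℝ] ℝ :=
  ∑ k, ((cellForm (CellBdd.one k)).compl₁₂
        (dPoly 1 ∘ₗ T.cellPoly k ∘ₗ LinearMap.fst ℝ _ _ -
          dPoly 0 ∘ₗ T.cellPoly k ∘ₗ LinearMap.snd ℝ _ _) (T.cellPoly k) +
      ∑ e, (edgeForm (c.conductanceWeight.ratio_bdd k e)).compl₁₂
        (T.tangIn k e - T.tangOut k e) (T.cellPoly k))

variable {N} (α : ℝ) {Δt : ℝ}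

/-- When both component equations are added, the factors -n_y and n_x combine with the test
functions into the tangential trace of the test field. This puts the penalty term into the form of
`fluxForm`, with the same kind of trace in both arguments. The factor Δt/2 is the time step times
the 1/2 of the average. -/
lemma eStep_iff (hΔt : Δt ≠ 0) (E : T.EField N) (H : T.HField N) (P E' : T.EField N) :
    EStep c α Δt E H P E' ↔ ∀ w, c.massE N (E' - E) w = (Δt • c.curlE N) H w +
      ((Δt / 2) • c.impedanceWeight.fluxForm α T.tangIn T.tangOut) (E + P) w := by
  set F : Fin 2 → Fin T.K → Poly N →ₗ[ℝ] ℝ := fun i k =>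
    (Δt⁻¹ • (cellForm (c.cellBdd_eps k i 0) (T.cellPoly k (E' - E).1) +
      cellForm (c.cellBdd_eps k i 1) (T.cellPoly k (E' - E).2))) ∘ₗ Submodule.subtype _ with hF
  set L : (k : Fin T.K) → Fin 3 → MvPolynomial (Fin 2) ℝ →ₗ[ℝ] ℝ := fun k e =>
    edgeForm (c.impedanceWeight.ratio_bdd k e) (T.cellPoly k H - T.nbrPoly k e H) -
      fluxParam α k e • (1 / 2 : ℝ) • edgeForm (c.impedanceWeight.sum_inv_bdd k e)
        (T.tangIn k e (E + P) - T.tangOut k e (E + P)) with hL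
  set G : Fin T.K → Poly N →ₗ[ℝ] ℝ := fun k =>
    (cellForm (CellBdd.one k) (dPoly 1 (T.cellPoly k H)) +
      ∑ e, (-(T.normal k e 1)) • L k e) ∘ₗ Submodule.subtype _ with hG
  set G' : Fin T.K → Poly N →ₗ[ℝ] ℝ := fun k =>
    (-cellForm (CellBdd.one k) (dPoly 0 (T.cellPoly k H)) +
      ∑ e, T.normal k e 0 • L k e) ∘ₗ Submodule.subtype _ with hG'
  have hmass : ∀ i k (u : Poly N), ∫ x in T.cell k,
      (c.eps k x i 0 * ((val (E'.1 k) x - val (E.1 k) x) / Δt)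
        + c.eps k x i 1 * ((val (E'.2 k) x - val (E.2 k) x) / Δt)) * val u x = F i k u := by
    intro i k u
    simp only [hF, LinearMap.comp_apply, LinearMap.smul_apply, LinearMap.add_apply, smul_eq_mul,
      cellForm_apply]
    rw [← integral_add (((c.cellBdd_eps k i 0).mul (.val _)).mul (.val _)).integrableOn
      (((c.cellBdd_eps k i 1).mul (.val _)).mul (.val _)).integrableOn, ← integral_const_mul]
    congr 1
    ext x
    simp only [Prod.fst_sub, Prod.snd_sub, map_sub, val_sub, cellPoly_apply, Submodule.subtype_apply]
    ring
  have hcurl : ∀ i k (u : Poly N),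
      ∫ x in T.cell k, val (MvPolynomial.pderiv i (H k : MvPolynomial (Fin 2) ℝ)) x * val u x =
        cellForm (CellBdd.one k) (dPoly i (T.cellPoly k H)) u := by
    intro i k u
    simp only [cellForm_apply, one_mul, dPoly_apply, cellPoly_apply]
  have hflux : ∀ (s : ℝ) k e (u : Poly N), T.edgeInt k e (fun x =>
      s * fluxE c α ((1 / 2 : ℝ) • (E + P)) H k e x * val u x) = s * L k e u := by
    intro s k e u
    simp only [fluxE, jump_eq, tjump_eq]
    refine (c.impedanceWeight.edgeInt_flux k e s (fluxParam α k e) _ _ _).trans ?_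
    simp only [hL, LinearMap.sub_apply, LinearMap.smul_apply, smul_eq_mul, map_smul, ← smul_sub]
  unfold EStep
  simp only [hmass, hcurl, hflux]
  have h1 : ∀ k (u : Poly N), cellForm (CellBdd.one k) (dPoly 1 (T.cellPoly k H)) u +
      ∑ e, -(T.normal k e 1) * L k e u = G k u := fun k u => by
    simp [hG, LinearMap.sum_apply]
  have h2 : ∀ k (u : Poly N), -cellForm (CellBdd.one k) (dPoly 0 (T.cellPoly k H)) u +
      ∑ e, T.normal k e 0 * L k e u = G' k u := fun k u => by
    simp [hG', LinearMap.sum_apply]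
  simp only [h1, h2]
  rw [forall_cell_pair_iff]
  refine forall_congr' fun w => ?_
  have e1 : c.massE N (E' - E) w = Δt * ∑ k, (F 0 k (w.1 k) + F 1 k (w.2 k)) := by
    simp only [massE, hF, LinearMap.sum_apply, LinearMap.add_apply, LinearMap.compl₁₂_apply,
      LinearMap.comp_apply, LinearMap.smul_apply, smul_eq_mul, LinearMap.fst_apply,
      LinearMap.snd_apply, Submodule.subtype_apply, Finset.mul_sum, cellPoly_apply]
    refine Finset.sum_congr rfl fun k _ => ?_
    field_simp
    ring
  have e2 : (Δt • c.curlE N) H w +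
      ((Δt / 2) • c.impedanceWeight.fluxForm α T.tangIn T.tangOut) (E + P) w =
      Δt * ∑ k, (G k (w.1 k) + G' k (w.2 k)) := by
    simp only [curlE, EdgeWeight.fluxForm, hG, hG', hL, LinearMap.sum_apply, LinearMap.add_apply,
      LinearMap.sub_apply, LinearMap.neg_apply, LinearMap.compl₁₂_apply, LinearMap.comp_apply,
      LinearMap.smul_apply, smul_eq_mul, LinearMap.fst_apply, LinearMap.snd_apply,
      Submodule.subtype_apply]
    rw [mul_neg, ← sub_eq_add_neg, show Δt / 2 = Δt * (1 / 2) by ring, mul_assoc, ← mul_sub,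
      Finset.mul_sum _ _ (1 / 2 : ℝ), ← Finset.sum_sub_distrib]
    congr 1
    refine Finset.sum_congr rfl fun k _ => ?_
    rw [Finset.mul_sum, add_sub_assoc, ← Finset.sum_sub_distrib, add_add_add_comm,
      ← Finset.sum_add_distrib]
    congr 1
    refine Finset.sum_congr rfl fun e _ => ?_
    rw [show T.tangIn k e w = T.normal k e 0 • T.cellPoly k w.2 - T.normal k e 1 • T.cellPoly k w.1
      from rfl]
    simp only [map_sub, map_smul, smul_eq_mul, cellPoly_apply]
    ring
  rw [e1, e2, mul_right_inj' hΔt]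

lemma hStep_iff (hΔt : Δt ≠ 0) (E : T.EField N) (H P H' : T.HField N) :
    HStep c α Δt E H P H' ↔ ∀ w, c.massH N (H' - H) w = (Δt • c.curlH N) E w +
      ((Δt / 2) • c.conductanceWeight.fluxForm α (fun k _ => T.cellPoly k) T.nbrPoly)
        (H + P) w := by
  set F : Fin T.K → Poly N →ₗ[ℝ] ℝ := fun k =>
    (Δt⁻¹ • cellForm (c.cellBdd_mu k) (T.cellPoly k (H' - H))) ∘ₗ Submodule.subtype _ with hF
  set L : (k : Fin T.K) → Fin 3 → MvPolynomial (Fin 2) ℝ →ₗ[ℝ] ℝ := fun k e =>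
    edgeForm (c.conductanceWeight.ratio_bdd k e) (T.tangIn k e E - T.tangOut k e E) -
      fluxParam α k e • (1 / 2 : ℝ) • edgeForm (c.conductanceWeight.sum_inv_bdd k e)
        (T.cellPoly k (H + P) - T.nbrPoly k e (H + P)) with hL
  set G : Fin T.K → Poly N →ₗ[ℝ] ℝ := fun k =>
    (cellForm (CellBdd.one k) (dPoly 1 (T.cellPoly k E.1) - dPoly 0 (T.cellPoly k E.2)) +
      ∑ e, L k e) ∘ₗ Submodule.subtype _ with hG
  have hmass : ∀ k (u : Poly N), ∫ x in T.cell k,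
      c.mu k x * ((val (H' k) x - val (H k) x) / Δt) * val u x = F k u := by
    intro k u
    simp only [hF, LinearMap.comp_apply, LinearMap.smul_apply, smul_eq_mul, cellForm_apply]
    rw [← integral_const_mul]
    congr 1
    ext x
    simp only [map_sub, val_sub, cellPoly_apply, Submodule.subtype_apply]
    ring
  have hcurl : ∀ k (u : Poly N),
      ∫ x in T.cell k, (val (MvPolynomial.pderiv 1 (E.1 k : MvPolynomial (Fin 2) ℝ)) x
          - val (MvPolynomial.pderiv 0 (E.2 k : MvPolynomial (Fin 2) ℝ)) x) * val u x =
        cellForm (CellBdd.one k) (dPoly 1 (T.cellPoly k E.1) - dPoly 0 (T.cellPoly k E.2)) u := by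
    intro k u
    simp only [cellForm_apply, one_mul, dPoly_apply, cellPoly_apply, val_sub]
  have hflux : ∀ k e (u : Poly N), T.edgeInt k e (fun x =>
      fluxH c α E ((1 / 2 : ℝ) • (H + P)) k e x * val u x) = L k e u := by
    intro k e u
    simp only [fluxH, jump_eq, tjump_eq]
    have := c.conductanceWeight.edgeInt_flux k e 1 (fluxParam α k e)
      (T.tangIn k e E - T.tangOut k e E) (T.cellPoly k ((1 / 2 : ℝ) • (H + P)) -
        T.nbrPoly k e ((1 / 2 : ℝ) • (H + P))) u
    simp only [one_mul] at this
    refine this.trans ?_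
    simp only [hL, LinearMap.sub_apply, LinearMap.smul_apply, smul_eq_mul, map_smul, ← smul_sub]
  unfold HStep
  simp only [hmass, hcurl, hflux]
  have h1 : ∀ k (u : Poly N),
      cellForm (CellBdd.one k) (dPoly 1 (T.cellPoly k E.1) - dPoly 0 (T.cellPoly k E.2)) u +
      ∑ e, L k e u = G k u := fun k u => by
    simp [hG, LinearMap.sum_apply]
  simp only [h1]
  rw [forall_cell_iff]
  refine forall_congr' fun w => ?_
  have e1 : c.massH N (H' - H) w = Δt * ∑ k, F k (w k) := by
    simp only [massH, hF, LinearMap.sum_apply, LinearMap.compl₁₂_apply,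
      LinearMap.comp_apply, LinearMap.smul_apply, smul_eq_mul, Submodule.subtype_apply,
      Finset.mul_sum, cellPoly_apply]
    refine Finset.sum_congr rfl fun k _ => ?_
    field_simp
  have e2 : (Δt • c.curlH N) E w +
      ((Δt / 2) • c.conductanceWeight.fluxForm α (fun k _ => T.cellPoly k) T.nbrPoly) (H + P) w =
      Δt * ∑ k, G k (w k) := by
    simp only [curlH, EdgeWeight.fluxForm, hG, hL, LinearMap.sum_apply, LinearMap.add_apply,
      LinearMap.sub_apply, LinearMap.neg_apply, LinearMap.compl₁₂_apply, LinearMap.comp_apply,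
      LinearMap.smul_apply, smul_eq_mul, LinearMap.fst_apply, LinearMap.snd_apply,
      Submodule.subtype_apply]
    rw [mul_neg, ← sub_eq_add_neg, show Δt / 2 = Δt * (1 / 2) by ring, mul_assoc, ← mul_sub,
      Finset.mul_sum _ _ (1 / 2 : ℝ), ← Finset.sum_sub_distrib]
    congr 1
    refine Finset.sum_congr rfl fun k _ => ?_
    rw [Finset.mul_sum, add_sub_assoc, ← Finset.sum_sub_distrib]
    congr 1
    refine Finset.sum_congr rfl fun e _ => ?_
    simp only [cellPoly_apply]
    ring
  rw [e1, e2, mul_right_inj' hΔt]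

end Coefficients

/-! ### Energy estimates -/

namespace TriMesh

variable {T : TriMesh} {N : ℕ}

/-- A polynomial that vanishes almost everywhere on the cell vanishes on its interior by continuity.
The interior is nonempty because the triangle is nondegenerate; it contains a product of two
intervals, and a polynomial vanishing on a product of infinite sets is zero. -/
lemma eq_zero_of_setIntegral_sq_eq_zero (k : Fin T.K) {p : MvPolynomial (Fin 2) ℝ}
    (h : ∫ x in T.cell k, val p x ^ 2 = 0) : p = 0 := by
  have hint : IntegrableOn (fun x => val p x ^ 2) (T.cell k) :=
    (CellBdd.of_continuous ((continuous_val p).pow 2)).integrableOn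
  have hae := (setIntegral_eq_zero_iff_of_nonneg_ae
    (Eventually.of_forall fun x => sq_nonneg (val p x)) hint).1 h
  have hae' : val p =ᵐ[volume.restrict (interior (T.cell k))] fun _ => 0 := by
    filter_upwards [ae_restrict_of_ae_restrict_of_subset interior_subset hae] with x hx
    exact pow_eq_zero_iff two_ne_zero |>.1 hx
  have heq := Measure.eqOn_open_of_ae_eq hae' isOpen_interior (continuous_val p).continuousOn
    continuousOn_const
  obtain ⟨x₀, hx₀⟩ := T.interior_cell_nonempty k
  have hopen : IsOpen ((fun y : Fin 2 → ℝ => (WithLp.toLp 2 y : Plane)) ⁻¹'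
      interior (T.cell k)) := isOpen_interior.preimage (by fun_prop)
  obtain ⟨r, hr, hball⟩ := Metric.isOpen_iff.1 hopen (fun i => x₀ i) hx₀
  rw [ball_pi _ hr] at hball
  refine MvPolynomial.funext_set (fun i => Metric.ball (x₀ i) r) (fun i => ?_) fun y hy => ?_
  · rw [Real.ball_eq_Ioo]
    exact Set.Ioo_infinite (by linarith)
  · rw [map_zero]
    exact heq (hball hy)

lemma cell_sq_nonneg (k : Fin T.K) (p : MvPolynomial (Fin 2) ℝ) :
    0 ≤ ∫ x in T.cell k, val p x ^ 2 := integral_nonneg fun _ => sq_nonneg _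

lemma integrableOn_sq (k : Fin T.K) (p : MvPolynomial (Fin 2) ℝ) :
    IntegrableOn (fun x => val p x ^ 2) (T.cell k) :=
  (CellBdd.of_continuous ((continuous_val p).pow 2)).integrableOn

lemma normH_sq (v : T.HField N) : normH v ^ 2 = ∑ k, ∫ x in T.cell k, val (v k) x ^ 2 :=
  Real.sq_sqrt (Finset.sum_nonneg fun k _ => cell_sq_nonneg k _)

lemma eq_zero_of_normH {H : T.HField N} (h : normH H ^ 2 ≤ 0) :
    H = 0 := by
  rw [normH_sq] at h
  have h0 := (Finset.sum_eq_zero_iff_of_nonneg fun k _ => cell_sq_nonneg k _).1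
    (le_antisymm h (Finset.sum_nonneg fun k _ => cell_sq_nonneg k _))
  funext k
  exact Subtype.ext (eq_zero_of_setIntegral_sq_eq_zero k (h0 k (Finset.mem_univ _)))

lemma edgeBdd_sq (k : Fin T.K) (e : Fin 3) (p : MvPolynomial (Fin 2) ℝ) :
    T.EdgeBdd k e fun x => val p x ^ 2 := .of_continuous ((continuous_val p).pow 2)

lemma hMin_le (k : Fin T.K) : T.hMin ≤ T.h k := ciInf_le (Set.finite_range _).bddBelow k

lemma le_of_sqrt_trace {A C B h I m : ℝ} (hA : 0 ≤ A) (hB : 0 ≤ B) (hm : 0 < m) (hmh : m ≤ h)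
    (hI : 0 ≤ I) (htr : √A ≤ C * √B / √h * √I) : A ≤ C ^ 2 * B / m * I := by
  have hh : 0 < h := hm.trans_le hmh
  have h1 := mul_self_le_mul_self (Real.sqrt_nonneg A) htr
  rw [Real.mul_self_sqrt hA] at h1
  have h2 : C * √B / √h * √I * (C * √B / √h * √I) = C ^ 2 * B / h * I := by
    have e1 := Real.sq_sqrt hB
    have e2 := Real.sq_sqrt hI
    have e3 := Real.sq_sqrt hh.le
    calc _ = C ^ 2 * √B ^ 2 / √h ^ 2 * √I ^ 2 := by ring
      _ = _ := by rw [e1, e2, e3]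
  rw [h2] at h1
  exact h1.trans (mul_le_mul_of_nonneg_right
    (div_le_div_of_nonneg_left (by positivity) hm hmh) hI)

lemma EdgeTrace.sq_le {C : ℝ} (h : T.EdgeTrace N C) (hm : 0 < T.hMin) (k : Fin T.K) (e : Fin 3)
    (u : Poly N) : T.edgeInt k e (fun x => val u x ^ 2) ≤
      C ^ 2 * (((N : ℝ) + 1) * ((N : ℝ) + 2)) / T.hMin * ∫ x in T.cell k, val u x ^ 2 :=
  le_of_sqrt_trace (edgeInt_nonneg fun _ _ => sq_nonneg _) (by positivity) hm (hMin_le k)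
    (cell_sq_nonneg k _) (h k e u)

lemma BoundaryTrace.sq_le {C : ℝ} (h : T.BoundaryTrace N C) (hm : 0 < T.hMin) (k : Fin T.K)
    (u : Poly N) : ∑ e : Fin 3, T.edgeInt k e (fun x => val u x ^ 2) ≤
      C ^ 2 * (((N : ℝ) + 1) * ((N : ℝ) + 2)) / T.hMin * ∫ x in T.cell k, val u x ^ 2 :=
  le_of_sqrt_trace (Finset.sum_nonneg fun _ _ => edgeInt_nonneg fun _ _ => sq_nonneg _)
    (by positivity) hm (hMin_le k) (cell_sq_nonneg k _) (h k u)

end TriMesh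

namespace Coefficients

variable {T : TriMesh} (c : Coefficients T) {N : ℕ}

lemma eps_symm (k : Fin T.K) (p q : MvPolynomial (Fin 2) ℝ) :
    cellForm (c.cellBdd_eps k 0 1) p q = cellForm (c.cellBdd_eps k 1 0) q p := by
  simp only [cellForm_apply]
  apply integral_congr_ae
  filter_upwards [c.admissible_cell k] with x hx
  rw [hx.1.apply 0 1]
  ring

lemma cellForm_comm {k : Fin T.K} {g : Plane → ℝ} (hg : T.CellBdd k g)
    (p q : MvPolynomial (Fin 2) ℝ) : cellForm hg p q = cellForm hg q p := by
  simp only [cellForm_apply]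
  congr 1
  ext x
  ring

lemma massE_apply (E w : T.EField N) : c.massE N E w = ∑ k,
    (cellForm (c.cellBdd_eps k 0 0) (E.1 k) (w.1 k) +
      cellForm (c.cellBdd_eps k 0 1) (E.2 k) (w.1 k) +
      cellForm (c.cellBdd_eps k 1 0) (E.1 k) (w.2 k) +
      cellForm (c.cellBdd_eps k 1 1) (E.2 k) (w.2 k)) := by
  simp [massE, LinearMap.sum_apply, cellPoly_apply]

lemma massE_symm (E w : T.EField N) : c.massE N E w = c.massE N w E := by
  rw [massE_apply, massE_apply]
  refine Finset.sum_congr rfl fun k _ => ?_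
  rw [cellForm_comm (c.cellBdd_eps k 0 0), cellForm_comm (c.cellBdd_eps k 1 1),
    c.eps_symm k (E.2 k) (w.1 k), c.eps_symm k (w.2 k) (E.1 k)]
  ring

lemma massH_apply (H w : T.HField N) :
    c.massH N H w = ∑ k, cellForm (c.cellBdd_mu k) (H k) (w k) := by
  simp [massH, LinearMap.sum_apply, cellPoly_apply]

lemma massH_symm (H w : T.HField N) : c.massH N H w = c.massH N w H := by
  rw [massH_apply, massH_apply]
  exact Finset.sum_congr rfl fun k _ => cellForm_comm _ _ _

/-- The electric energy density. -/
def densityE (k : Fin T.K) (p q : MvPolynomial (Fin 2) ℝ) (x : Plane) : ℝ :=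
  c.eps k x 0 0 * val p x ^ 2 + 2 * c.eps k x 0 1 * val p x * val q x +
    c.eps k x 1 1 * val q x ^ 2

lemma integrableOn_densityE (k : Fin T.K) (p q : MvPolynomial (Fin 2) ℝ) :
    IntegrableOn (c.densityE k p q) (T.cell k) := by
  have h0 := ((c.cellBdd_eps k 0 0).mul (.of_continuous ((continuous_val p).pow 2))).integrableOn
  have h1 := ((c.cellBdd_eps k 0 1).mul (.of_continuous
    (((continuous_val p).mul (continuous_val q)).const_mul 2))).integrableOn
  have h2 := ((c.cellBdd_eps k 1 1).mul (.of_continuous ((continuous_val q).pow 2))).integrableOn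
  refine ((h0.add h1).add h2).congr_fun (fun x _ => ?_) (T.measurableSet_cell k)
  simp only [densityE, Pi.add_apply, Pi.mul_apply, Pi.pow_apply]
  ring

lemma massE_self (E : T.EField N) :
    c.massE N E E = ∑ k, ∫ x in T.cell k, c.densityE k (E.1 k) (E.2 k) x := by
  rw [massE_apply]
  refine Finset.sum_congr rfl fun k _ => ?_
  rw [← eps_symm]
  have i0 := (((c.cellBdd_eps k 0 0).mul (.val (E.1 k))).mul (.val (E.1 k))).integrableOn
  have i1 := (((c.cellBdd_eps k 0 1).mul (.val (E.2 k))).mul (.val (E.1 k))).integrableOn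
  have i2 := (((c.cellBdd_eps k 1 1).mul (.val (E.2 k))).mul (.val (E.2 k))).integrableOn
  simp only [cellForm_apply]
  have j0 := integral_add i0 i1
  have j1 := integral_add (i0.add i1) i1
  have j2 := integral_add ((i0.add i1).add i1) i2
  simp only [Pi.add_apply] at j1 j2
  rw [← j0, ← j1, ← j2]
  congr 1
  ext x
  simp only [densityE]
  ring

lemma εlo_mul_le_densityE (k : Fin T.K) (p q : MvPolynomial (Fin 2) ℝ) :
    c.εlo * ((∫ x in T.cell k, val p x ^ 2) + ∫ x in T.cell k, val q x ^ 2) ≤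
      ∫ x in T.cell k, c.densityE k p q x := by
  rw [← integral_add (integrableOn_sq k p) (integrableOn_sq k q), ← integral_const_mul]
  refine integral_mono_ae (((integrableOn_sq k p).add (integrableOn_sq k q)).const_mul _)
    (c.integrableOn_densityE k p q) ?_
  filter_upwards [c.admissible_cell k] with x hx using (hx.quad_bounds _ _).1

lemma μlo_mul_le_massH (k : Fin T.K) (p : MvPolynomial (Fin 2) ℝ) :
    c.μlo * (∫ x in T.cell k, val p x ^ 2) ≤ cellForm (c.cellBdd_mu k) p p := by
  rw [cellForm_apply, ← integral_const_mul]
  refine integral_mono_ae ((integrableOn_sq k p).const_mul _)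
    (((c.cellBdd_mu k).mul (.val p)).mul (.val p)).integrableOn ?_
  filter_upwards [c.admissible_cell k] with x hx
  have := mul_le_mul_of_nonneg_right hx.2.2.1 (sq_nonneg (val p x))
  linarith

lemma normE_sq_le (E : T.EField N) : c.εlo * normE E ^ 2 ≤ c.massE N E E := by
  rw [normE, Real.sq_sqrt (by positivity), normH_sq, normH_sq, ← Finset.sum_add_distrib,
    Finset.mul_sum, massE_self]
  exact Finset.sum_le_sum fun k _ => c.εlo_mul_le_densityE k _ _

lemma normH_sq_le (H : T.HField N) : c.μlo * normH H ^ 2 ≤ c.massH N H H := by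
  rw [normH_sq, Finset.mul_sum, massH_apply]
  exact Finset.sum_le_sum fun k _ => c.μlo_mul_le_massH k _

lemma massE_pos (E : T.EField N) (hE : E ≠ 0) : 0 < c.massE N E E := by
  by_contra! hcon
  have h1 := c.normE_sq_le E
  have h2 : normE E ^ 2 ≤ 0 := by nlinarith [c.εlo_pos]
  rw [normE, Real.sq_sqrt (by positivity)] at h2
  exact hE (Prod.ext (eq_zero_of_normH (by nlinarith [sq_nonneg (normH E.2)]))
    (eq_zero_of_normH (by nlinarith [sq_nonneg (normH E.1)])))

lemma massH_pos (H : T.HField N) (hH : H ≠ 0) : 0 < c.massH N H H := by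
  by_contra! hcon
  have h1 := c.normH_sq_le H
  exact hH (eq_zero_of_normH (by nlinarith [c.μlo_pos]))

lemma minZ_pos : 0 < c.minZ := by
  have : Nonempty (Fin T.K) := ⟨⟨0, T.K_pos⟩⟩
  exact c.impedanceWeight.lo_pos.trans_le
    (le_ciInf fun p => c.impedanceWeight.le_inn p.1 p.2.1 p.2.2 p.2.2.2)

lemma minY_pos : 0 < c.minY := by
  have : Nonempty (Fin T.K) := ⟨⟨0, T.K_pos⟩⟩
  exact c.conductanceWeight.lo_pos.trans_le
    (le_ciInf fun p => c.conductanceWeight.le_inn p.1 p.2.1 p.2.2 p.2.2.2)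

lemma minZ_le (k : Fin T.K) (e : Fin 3) {t : ℝ} (ht : t ∈ Set.Icc (0 : ℝ) 1) :
    c.minZ ≤ c.Zin k e (T.edgePt k e t) :=
  ciInf_le (f := fun p : Fin T.K × Fin 3 × Set.Icc (0 : ℝ) 1 =>
      c.Zin p.1 p.2.1 (T.edgePt p.1 p.2.1 p.2.2))
    ⟨0, by rintro _ ⟨p, rfl⟩; exact (c.Zin_bounds p.1 p.2.1 p.2.2.2).1.le⟩ (k, e, ⟨t, ht⟩)

lemma minY_le (k : Fin T.K) (e : Fin 3) {t : ℝ} (ht : t ∈ Set.Icc (0 : ℝ) 1) :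
    c.minY ≤ c.Yin k e (T.edgePt k e t) :=
  ciInf_le (f := fun p : Fin T.K × Fin 3 × Set.Icc (0 : ℝ) 1 =>
      c.Yin p.1 p.2.1 (T.edgePt p.1 p.2.1 p.2.2))
    ⟨0, by rintro _ ⟨p, rfl⟩; exact (inv_pos.2 (c.Zin_bounds p.1 p.2.1 p.2.2.2).1).le⟩
    (k, e, ⟨t, ht⟩)

/-! ### Weighted traces controlled by the energy -/

variable {Cτ : ℝ}

/-- For variable coefficients the weight on an edge is not comparable with the energy density inside
by a pointwise identity, so 1/Z is replaced by 1/min Z and the tangential component by the whole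
vector. The trace inequality is then applied to each component on the whole boundary. -/
lemma edgeEnergy_E_le_of_boundaryTrace (h : T.BoundaryTrace N Cτ) (hm : 0 < T.hMin)
    (E : T.EField N) : c.impedanceWeight.edgeEnergy T.tangIn E ≤
      c.minZ⁻¹ * (Cτ ^ 2 * (((N : ℝ) + 1) * ((N : ℝ) + 2)) / T.hMin) * c.εlo⁻¹ *
        c.massE N E E := by
  rw [massE_self, Finset.mul_sum]
  refine Finset.sum_le_sum fun k _ => ?_
  have hedge : ∀ e, T.edgeInt k e
      (fun x => (c.impedanceWeight.inn k e x)⁻¹ * val (T.tangIn k e E) x ^ 2) ≤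
      c.minZ⁻¹ * (T.edgeInt k e (fun x => val (E.1 k) x ^ 2) +
        T.edgeInt k e (fun x => val (E.2 k) x ^ 2)) := by
    intro e
    rw [← edgeInt_add (edgeBdd_sq k e _) (edgeBdd_sq k e _), ← edgeInt_const_mul]
    refine edgeInt_mono (c.impedanceWeight.weighted_trace_bdd E)
      (((edgeBdd_sq k e _).add (edgeBdd_sq k e _)).const_mul _) fun t ht => ?_
    refine mul_le_mul (inv_anti₀ c.minZ_pos (c.minZ_le k e ht)) ?_ (sq_nonneg _)
      (inv_nonneg.2 c.minZ_pos.le)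
    have hn := T.normal_sq_add_sq k e
    simp only [tangIn, tangential_apply, val_sub, val_smul, cellPoly_apply]
    generalize T.normal k e 0 = a at *
    generalize T.normal k e 1 = b at *
    have : ∀ p q : ℝ, (a * q - b * p) ^ 2 ≤ p ^ 2 + q ^ 2 := fun p q => by
      have : (p ^ 2 + q ^ 2) - (a * q - b * p) ^ 2 = (a * p + b * q) ^ 2 := by
        linear_combination (-p ^ 2 - q ^ 2) * hn
      nlinarith [sq_nonneg (a * p + b * q)]
    exact this _ _
  refine (Finset.sum_le_sum fun e _ => hedge e).trans ?_
  rw [← Finset.mul_sum, Finset.sum_add_distrib, mul_assoc, mul_assoc]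
  refine mul_le_mul_of_nonneg_left ?_ (inv_nonneg.2 c.minZ_pos.le)
  refine (add_le_add (h.sq_le hm k (E.1 k)) (h.sq_le hm k (E.2 k))).trans ?_
  rw [← mul_add]
  refine mul_le_mul_of_nonneg_left ?_ (by positivity)
  rw [← div_eq_inv_mul, le_div_iff₀ c.εlo_pos, mul_comm]
  exact c.εlo_mul_le_densityE k _ _

lemma edgeEnergy_H_le_of_boundaryTrace (h : T.BoundaryTrace N Cτ) (hm : 0 < T.hMin)
    (H : T.HField N) : c.conductanceWeight.edgeEnergy (fun k _ => T.cellPoly k) H ≤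
      c.minY⁻¹ * (Cτ ^ 2 * (((N : ℝ) + 1) * ((N : ℝ) + 2)) / T.hMin) * c.μlo⁻¹ *
        c.massH N H H := by
  rw [massH_apply, Finset.mul_sum]
  refine Finset.sum_le_sum fun k _ => ?_
  have hedge : ∀ e, T.edgeInt k e
      (fun x => (c.conductanceWeight.inn k e x)⁻¹ * val (T.cellPoly k H) x ^ 2) ≤
      c.minY⁻¹ * T.edgeInt k e (fun x => val (H k) x ^ 2) := by
    intro e
    rw [← edgeInt_const_mul]
    refine edgeInt_mono
      (c.conductanceWeight.weighted_trace_bdd (i := fun k _ => T.cellPoly k) H)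
      ((edgeBdd_sq k e _).const_mul _) fun t ht => ?_
    exact mul_le_mul_of_nonneg_right (inv_anti₀ c.minY_pos (c.minY_le k e ht)) (sq_nonneg _)
  refine (Finset.sum_le_sum fun e _ => hedge e).trans ?_
  rw [← Finset.mul_sum, mul_assoc, mul_assoc]
  refine mul_le_mul_of_nonneg_left ?_ (inv_nonneg.2 c.minY_pos.le)
  refine (h.sq_le hm k (H k)).trans (mul_le_mul_of_nonneg_left ?_ (by positivity))
  rw [← div_eq_inv_mul, le_div_iff₀ c.μlo_pos, mul_comm]
  exact c.μlo_mul_le_massH k _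

/-- Constancy holds on the closed cell, edges included, so the value at the end point t = 0 of the
edge represents both the trace and the interior value. -/
lemma edgeInt_weight_of_cellwiseConstant (hc : c.CellwiseConstant) {k : Fin T.K} {e : Fin 3}
    (s : Plane → ℝ) (z : Matrix (Fin 2) (Fin 2) ℝ → ℝ → ℝ) :
    T.edgeInt k e (fun x => z (c.eps k x) (c.mu k x) * s x) =
      z (c.eps k (T.edgePt k e 0)) (c.mu k (T.edgePt k e 0)) * T.edgeInt k e s := by
  rw [← edgeInt_const_mul]
  unfold edgeInt
  congr 1
  refine intervalIntegral.integral_congr fun t ht => ?_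
  rw [Set.uIcc_of_le zero_le_one] at ht
  have := hc k _ (T.edgePt_mem_cell k e ht) _ (T.edgePt_mem_cell k e (t := 0) (by simp))
  beta_reduce
  rw [this.1, this.2]

/-- The normal is constant along an edge, so the tangential component extends to a polynomial on the
cell and the trace inequality applies to it directly. The constant weight is then taken inside the
cell integral, where `sq_div_impedance_le` holds pointwise. The factor 3 counts the edges. -/
lemma edgeEnergy_E_le_of_cellwiseConstant (hc : c.CellwiseConstant) (h : T.EdgeTrace N Cτ)
    (hm : 0 < T.hMin) (E : T.EField N) : c.impedanceWeight.edgeEnergy T.tangIn E ≤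
      3 * (Cτ ^ 2 * (((N : ℝ) + 1) * ((N : ℝ) + 2)) / T.hMin) * (min c.εlo c.μlo)⁻¹ *
        c.massE N E E := by
  rw [massE_self, Finset.mul_sum]
  refine Finset.sum_le_sum fun k _ => ?_
  have hedge : ∀ e, T.edgeInt k e
      (fun x => (c.impedanceWeight.inn k e x)⁻¹ * val (T.tangIn k e E) x ^ 2) ≤
      (Cτ ^ 2 * (((N : ℝ) + 1) * ((N : ℝ) + 2)) / T.hMin) * ((min c.εlo c.μlo)⁻¹ *
        ∫ x in T.cell k, c.densityE k (E.1 k) (E.2 k) x) := by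
    intro e
    have ht0 : (0 : ℝ) ∈ Set.Icc (0 : ℝ) 1 := by simp
    have hz := (c.Zin_bounds k e ht0).1
    have htr := h.sq_le hm k e (T.normal k e 0 • E.2 k - T.normal k e 1 • E.1 k)
    refine (c.edgeInt_weight_of_cellwiseConstant hc _
      (fun A m => (impedance A m (T.normal k e))⁻¹)).trans_le ?_
    refine (mul_le_mul_of_nonneg_left htr (inv_nonneg.2 hz.le)).trans ?_
    rw [mul_left_comm]
    refine mul_le_mul_of_nonneg_left ?_ (by positivity)
    rw [← integral_const_mul, ← integral_const_mul]
    refine setIntegral_mono_on ((integrableOn_sq k _).const_mul _)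
      ((c.integrableOn_densityE k _ _).const_mul _) (T.measurableSet_cell k) fun x hx => ?_
    have hA := (c.admissible_edge k e 0 ht0).sq_div_impedance_le c.εlo_pos c.μlo_pos
      (T.normal_sq_add_sq k e) (val (E.1 k) x) (val (E.2 k) x)
    have hcx := (hc k x hx _ (T.edgePt_mem_cell k e ht0)).1
    simp only [densityE, hcx]
    refine le_trans (le_of_eq ?_) hA
    congr 2
    exact (val_sub _ _ _).trans (by rw [Submodule.coe_smul, Submodule.coe_smul, val_smul, val_smul])
  refine (Finset.sum_le_sum fun e _ => hedge e).trans (le_of_eq ?_)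
  simp only [Finset.sum_const, Finset.card_univ, Fintype.card_fin, nsmul_eq_mul]
  push_cast
  ring

/-- The inverse of the conductance weight is Z, which `impedance_le` bounds by μ over the smaller
lower bound, so the magnetic energy density appears directly. -/
lemma edgeEnergy_H_le_of_cellwiseConstant (hc : c.CellwiseConstant) (h : T.EdgeTrace N Cτ)
    (hm : 0 < T.hMin) (H : T.HField N) :
    c.conductanceWeight.edgeEnergy (fun k _ => T.cellPoly k) H ≤
      3 * (Cτ ^ 2 * (((N : ℝ) + 1) * ((N : ℝ) + 2)) / T.hMin) * (min c.εlo c.μlo)⁻¹ *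
        c.massH N H H := by
  rw [massH_apply, Finset.mul_sum]
  refine Finset.sum_le_sum fun k _ => ?_
  have hedge : ∀ e, T.edgeInt k e
      (fun x => (c.conductanceWeight.inn k e x)⁻¹ * val (T.cellPoly k H) x ^ 2) ≤
      (Cτ ^ 2 * (((N : ℝ) + 1) * ((N : ℝ) + 2)) / T.hMin) * ((min c.εlo c.μlo)⁻¹ *
        cellForm (c.cellBdd_mu k) (H k) (H k)) := by
    intro e
    have ht0 : (0 : ℝ) ∈ Set.Icc (0 : ℝ) 1 := by simp
    have hz := (c.Zin_bounds k e ht0).1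
    refine (c.edgeInt_weight_of_cellwiseConstant hc _
      (fun A m => (impedance A m (T.normal k e))⁻¹⁻¹)).trans_le ?_
    rw [inv_inv]
    refine (mul_le_mul_of_nonneg_left (h.sq_le hm k e (H k)) hz.le).trans ?_
    rw [mul_left_comm, cellForm_apply]
    refine mul_le_mul_of_nonneg_left ?_ (by positivity)
    rw [← integral_const_mul, ← integral_const_mul]
    refine setIntegral_mono_on ((integrableOn_sq k _).const_mul _)
      ((((c.cellBdd_mu k).mul (.val (H k))).mul (.val (H k))).integrableOn.const_mul _)
      (T.measurableSet_cell k) fun x hx => ?_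
    have hA := (c.admissible_edge k e 0 ht0).impedance_le c.εlo_pos c.μlo_pos
      (T.normal_sq_add_sq k e)
    rw [(hc k x hx _ (T.edgePt_mem_cell k e ht0)).2]
    exact (mul_le_mul_of_nonneg_right hA (sq_nonneg (val (H k) x))).trans_eq (by ring)
  refine (Finset.sum_le_sum fun e _ => hedge e).trans (le_of_eq ?_)
  simp only [Finset.sum_const, Finset.card_univ, Fintype.card_fin, nsmul_eq_mul]
  push_cast
  ring

end Coefficients

namespace Coefficients

variable {T : TriMesh} (c : Coefficients T) {N : ℕ} {α Δt Cτ Cinv : ℝ}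

/-! ### The time step restriction -/

/-- Derivatives act only on known fields, so the summand of the inverse inequality is simply dropped
as nonnegative. -/
lemma le_CE (hCinv : 0 < Cinv) : Cτ ^ 2 * (((N : ℝ) + 1) * ((N : ℝ) + 2)) *
    (5 / 2 + (α + 1 / 4) / c.minZ) ≤ c.CE N α Cτ Cinv := by
  have : 0 ≤ 1 / 2 * Cinv * (N : ℝ) ^ 2 := by positivity
  unfold CE
  linarith

lemma le_CH (hCinv : 0 < Cinv) : Cτ ^ 2 * (((N : ℝ) + 1) * ((N : ℝ) + 2)) *
    (5 / 2 + (α + 1 / 2) / c.minY) ≤ c.CH N α Cτ Cinv := by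
  have : 0 ≤ 1 / 2 * Cinv * (N : ℝ) ^ 2 := by positivity
  unfold CH
  linarith

/-- Besides clearing denominators, this reads the positivity of the mesh size off the restriction
itself, since 0 < Δt. -/
lemma mul_lt_of_timestep {lo h A B X : ℝ} (hlo : 0 < lo) (hΔt : 0 < Δt) (hX : 0 < X)
    (hXC : X ≤ max A B) (hCFL : Δt < lo / max A B * h) : 0 < h ∧ Δt * X < lo * h := by
  have hmax : 0 < max A B := hX.trans_le hXC
  rw [div_mul_eq_mul_div, lt_div_iff₀ hmax] at hCFL
  exact ⟨pos_of_mul_pos_right ((mul_pos hΔt hmax).trans hCFL) hlo.le,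
    (mul_le_mul_of_nonneg_left hXC hΔt.le).trans_lt hCFL⟩

/-- The contraction factor for coefficients that are constant on the triangles. -/
lemma factor_lt_of_constant {D lo h s : ℝ} (hα : α = 0 ∨ α = 1) (hlo : 0 < lo) (hh : 0 < h)
    (hΔt : 0 < Δt) (hD : 0 < D) (hs : 0 ≤ s) (hX : Δt * (D * (5 / 2 + s)) < lo * h) :
    Δt * (3 * (D / h) * lo⁻¹) < 4 / (1 + 2 * α) := by
  have h1 : Δt * (3 * (D / h) * lo⁻¹) = 3 * (Δt * D) / (lo * h) := by field_simp
  have h2 : 0 ≤ Δt * D * s := by positivity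
  -- The summand 5/2 gives Δt D < (2/5) lo h. The resulting 6/5 is below 4/3, the smaller of the two
  -- thresholds, attained at α = 1.
  have h3 : 3 * (Δt * D) / (lo * h) < 6 / 5 := by
    rw [div_lt_iff₀ (by positivity)]
    linarith
  rw [h1]
  rcases hα with rfl | rfl <;> norm_num <;> linarith

/-- The contraction factor from the trace inequality on the whole boundary. -/
lemma factor_lt_of_boundary {D lo lo' h β z : ℝ} (hα : α = 0 ∨ α = 1) (hlo : 0 < lo)
    (hlo' : lo ≤ lo') (hh : 0 < h) (hΔt : 0 < Δt) (hD : 0 < D) (hz : 0 < z) (hβ : 1 / 4 ≤ β)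
    (hX : Δt * (D * (5 / 2 + (α + β) / z)) < lo * h) :
    Δt * (z⁻¹ * (D / h) * lo'⁻¹) < 4 / (1 + 2 * α) := by
  have hlo0 : 0 < lo' := hlo.trans_le hlo'
  have h1 : Δt * (z⁻¹ * (D / h) * lo'⁻¹) = (Δt * D / z) / (lo' * h) := by field_simp
  have h0 : 0 < Δt * D := mul_pos hΔt hD
  have h2 : 0 < Δt * D / z := by positivity
  have h3 : Δt * (D * (5 / 2 + (α + β) / z)) = 5 / 2 * (Δt * D) + (Δt * D / z) * (α + β) := by
    field_simp
  rw [h3] at hX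
  have h4 : lo * h ≤ lo' * h := mul_le_mul_of_nonneg_right hlo' hh.le
  rw [h1, div_lt_iff₀ (by positivity)]
  -- The restriction bounds the left-hand quotient by 1/(α + 1/4), which is at most 4/(1 + 2α), with
  -- equality at α = 0. This is what the summand 1/4 in C_E is for.
  rcases hα with rfl | rfl <;> nlinarith

lemma exists_trace_constant_E (hα : α = 0 ∨ α = 1) (hΔt : 0 < Δt) (hCτ : 0 < Cτ)
    (hCinv : 0 < Cinv) (htrace : T.EdgeTrace N Cτ)
    (hcoef : c.CellwiseConstant ∨ T.BoundaryTrace N Cτ)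
    (hCFL : Δt < min c.εlo c.μlo / max (c.CE N α Cτ Cinv) (c.CH N α Cτ Cinv) * T.hMin) :
    ∃ r, 0 ≤ r ∧ r < 4 / (1 + 2 * α) ∧ ∀ E : T.EField N,
      Δt * c.impedanceWeight.edgeEnergy T.tangIn E ≤ r * c.massE N E E := by
  have hα0 : 0 ≤ α := by rcases hα with rfl | rfl <;> norm_num
  have hz := c.minZ_pos
  have hlo := lt_min c.εlo_pos c.μlo_pos
  obtain ⟨hh, hX⟩ := mul_lt_of_timestep hlo hΔt (by positivity)
    ((c.le_CE (N := N) (α := α) (Cτ := Cτ) hCinv).trans (le_max_left _ _)) hCFL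
  have hε := c.εlo_pos
  rcases hcoef with hc | hb
  · refine ⟨_, ?_, factor_lt_of_constant hα hlo hh hΔt (by positivity) (by positivity) hX,
      fun E => ?_⟩
    · positivity
    · rw [mul_assoc Δt]
      exact mul_le_mul_of_nonneg_left (c.edgeEnergy_E_le_of_cellwiseConstant hc htrace hh E) hΔt.le
  · refine ⟨_, ?_, factor_lt_of_boundary hα hlo (min_le_left _ _) hh hΔt (by positivity) hz le_rfl
      hX, fun E => ?_⟩
    · positivity
    · rw [mul_assoc Δt]
      exact mul_le_mul_of_nonneg_left (c.edgeEnergy_E_le_of_boundaryTrace hb hh E) hΔt.le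

lemma exists_trace_constant_H (hα : α = 0 ∨ α = 1) (hΔt : 0 < Δt) (hCτ : 0 < Cτ)
    (hCinv : 0 < Cinv) (htrace : T.EdgeTrace N Cτ)
    (hcoef : c.CellwiseConstant ∨ T.BoundaryTrace N Cτ)
    (hCFL : Δt < min c.εlo c.μlo / max (c.CE N α Cτ Cinv) (c.CH N α Cτ Cinv) * T.hMin) :
    ∃ r, 0 ≤ r ∧ r < 4 / (1 + 2 * α) ∧ ∀ H : T.HField N,
      Δt * c.conductanceWeight.edgeEnergy (fun k _ => T.cellPoly k) H ≤ r * c.massH N H H := by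
  have hα0 : 0 ≤ α := by rcases hα with rfl | rfl <;> norm_num
  have hz := c.minY_pos
  have hlo := lt_min c.εlo_pos c.μlo_pos
  obtain ⟨hh, hX⟩ := mul_lt_of_timestep hlo hΔt (by positivity)
    ((c.le_CH (N := N) (α := α) (Cτ := Cτ) hCinv).trans (le_max_right _ _)) hCFL
  have hμ := c.μlo_pos
  rcases hcoef with hc | hb
  · refine ⟨_, ?_, factor_lt_of_constant hα hlo hh hΔt (by positivity) (by positivity) hX,
      fun H => ?_⟩
    · positivity
    · rw [mul_assoc Δt]
      exact mul_le_mul_of_nonneg_left (c.edgeEnergy_H_le_of_cellwiseConstant hc htrace hh H) hΔt.le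
  · refine ⟨_, ?_, factor_lt_of_boundary hα hlo (min_le_right _ _) hh hΔt (by positivity) hz
      (by norm_num) hX, fun H => ?_⟩
    · positivity
    · rw [mul_assoc Δt]
      exact mul_le_mul_of_nonneg_left (c.edgeEnergy_H_le_of_boundaryTrace hb hh H) hΔt.le

/-- The two reciprocals are added so that one constant serves both fields in `coupled_iteration`. -/
lemma normE_le (E : T.EField N) : normE E ≤ ((√c.εlo)⁻¹ + (√c.μlo)⁻¹) * √(c.massE N E E) := by
  have hs := Real.sqrt_pos.2 c.εlo_pos
  have h := Real.sqrt_le_sqrt (c.normE_sq_le E)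
  rw [Real.sqrt_mul c.εlo_pos.le, Real.sqrt_sq (by exact Real.sqrt_nonneg _)] at h
  rw [add_mul]
  refine le_add_of_le_of_nonneg ?_ (by positivity)
  rwa [← div_eq_inv_mul, le_div_iff₀ hs, mul_comm]

lemma normH_le (H : T.HField N) : normH H ≤ ((√c.εlo)⁻¹ + (√c.μlo)⁻¹) * √(c.massH N H H) := by
  have hs := Real.sqrt_pos.2 c.μlo_pos
  have h := Real.sqrt_le_sqrt (c.normH_sq_le H)
  rw [Real.sqrt_mul c.μlo_pos.le, Real.sqrt_sq (by exact Real.sqrt_nonneg _)] at h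
  rw [add_mul]
  refine le_add_of_nonneg_of_le (by positivity) ?_
  rwa [← div_eq_inv_mul, le_div_iff₀ hs, mul_comm]

end Coefficients

end MaxwellDG

end

/-! ### The convergence theorem -/

theorem theorem1 (T : MaxwellDG.TriMesh) (c : MaxwellDG.Coefficients T) (N M : ℕ)
    (α Δt Cτ Cinv : ℝ) (hα : α = 0 ∨ α = 1) (hΔt : 0 < Δt) (hCτ : 0 < Cτ) (hCinv : 0 < Cinv)
    (htrace : T.EdgeTrace N Cτ)
    (hcoef : c.CellwiseConstant ∨ T.BoundaryTrace N Cτ)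
    (hCFL : Δt < min c.εlo c.μlo / max (c.CE N α Cτ Cinv) (c.CH N α Cτ Cinv) * T.hMin) :
    -- every inner iteration is well defined
    ((∀ (E : T.EField N) (H : T.HField N) (P : T.EField N),
        ∃! E' : T.EField N, MaxwellDG.EStep c α Δt E H P E') ∧
      (∀ (E : T.EField N) (H P : T.HField N),
        ∃! H' : T.HField N, MaxwellDG.HStep c α Δt E H P H')) ∧
    -- in each time step the inner iterates converge to the solution of the implicit method,
    -- whether the magnetic equation uses the limit or the current iterate of the electric field
    (∀ (E : T.EField N) (H : T.HField N), ∃ (E' : T.EField N) (H' : T.HField N),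
      MaxwellDG.ImplicitStep c α Δt E H E' H' ∧
      (∀ (E'' : T.EField N) (H'' : T.HField N),
        MaxwellDG.ImplicitStep c α Δt E H E'' H'' → E'' = E' ∧ H'' = H') ∧
      ∀ (X Eit : ℕ → T.EField N) (Hit : ℕ → T.HField N),
        ((∀ n, X n = E') ∨ (∀ n, X n = Eit (n + 1))) →
        MaxwellDG.IsInnerIteration c α Δt E H X Eit Hit →
        Filter.Tendsto (fun n => MaxwellDG.TriMesh.normE (Eit n - E')) Filter.atTop (nhds 0) ∧
        Filter.Tendsto (fun n => MaxwellDG.TriMesh.normH (Hit n - H')) Filter.atTop (nhds 0)) ∧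
    -- over all time steps, the iterative method converges to the implicit method as the numbers
    -- of inner iterations tend to infinity
    (∀ (E₀ : T.EField N) (H₀ : T.HField N), ∃ (E : ℕ → T.EField N) (H : ℕ → T.HField N),
      MaxwellDG.IsImplicitSolution c α Δt M E₀ H₀ E H ∧
      (∀ (E' : ℕ → T.EField N) (H' : ℕ → T.HField N),
        MaxwellDG.IsImplicitSolution c α Δt M E₀ H₀ E' H' →
        ∀ m ≤ M, E' m = E m ∧ H' m = H m) ∧
      ∀ δ > (0 : ℝ), ∃ n₀ : ℕ, ∀ ν : ℕ → ℕ, (∀ m < M, n₀ ≤ ν m) →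
        ∀ (E' : ℕ → T.EField N) (H' : ℕ → T.HField N),
          MaxwellDG.IsIterativeRun c α Δt M ν E₀ H₀ E' H' →
          ∀ m ≤ M, MaxwellDG.TriMesh.normE (E' m - E m) < δ ∧
            MaxwellDG.TriMesh.normH (H' m - H m) < δ) := by
 
  obtain ⟨r, hr0, hr, hE⟩ :=
    c.exists_trace_constant_E hα hΔt hCτ hCinv htrace hcoef hCFL
  obtain ⟨r', hr0', hr', hH⟩ :=
    c.exists_trace_constant_H hα hΔt hCτ hCinv htrace hcoef hCFL
  -- The electric field uses the impedance as weight and its tangential traces; the magnetic field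
  -- below uses the conductance and its plain traces. Outer traces on the boundary are zero, in
  -- accordance with [v] = v⁻ there.
  obtain ⟨ρ, hρ0, hρ1, hb⟩ := c.impedanceWeight.exists_contraction α (o := T.tangOut) hα
    (fun h hs E x => MaxwellDG.TriMesh.val_tangOut_sq h hs E x)
    (fun h E => MaxwellDG.TriMesh.tangOut_of_none h E) hΔt hr0 hr hE
  obtain ⟨ρ', hρ0', hρ1', hb'⟩ := c.conductanceWeight.exists_contraction α (o := T.nbrPoly) hα
    (fun h _ v x => by rw [MaxwellDG.TriMesh.nbrPoly_of_some h])
    (fun h v => MaxwellDG.TriMesh.nbrPoly_of_none h v) hΔt hr0' hr' hH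
  have hε := Real.sqrt_pos.2 c.εlo_pos
  exact MaxwellDG.coupled_iteration (ES := MaxwellDG.EStep c α Δt) (HS := MaxwellDG.HStep c α Δt)
    c.massE_symm c.massE_pos c.massH_symm c.massH_pos
    (c.eStep_iff α hΔt.ne') (c.hStep_iff α hΔt.ne') hρ0 hρ1 hb hρ0' hρ1' hb'
    (by positivity) (fun _ => Real.sqrt_nonneg _) c.normE_le (fun _ => Real.sqrt_nonneg _)
    c.normH_le M
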